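/- Let $\Gamma$ be a finite tree (a finite connected simple graph without cycles) with vertex set $V$. For $0<\tau\le 1$ let $A_{\Gamma,\tau}$ be the unital $*$-algebra over $\mathbb{C}$ generated by elements $p_i$ ($i\in V$) with $p_i^2=p_i^*=p_i$ and the relations $p_ip_jp_i=\tau p_i$, $p_jp_ip_j=\tau p_j$ if $i$ and $j$ are adjacent, and $p_ip_j=p_jp_i=0$ if $i\neq j$ are not adjacent. Let $\Sigma_\Gamma\subset(0,1]$ be the set of those $\tau$ for which $A_{\Gamma,\tau}$ has a nontrivial unital $*$-representation by bounded operators on a complex Hilbert space, where nontrivial means that some $p_i$ is represented by a nonzero operator. Then $\Sigma_\Gamma$ has a maximum, and the following hold. 1. $\max\Sigma_\Gamma>1/4$ if and only if $\Gamma$ is isomorphic to one of the Dynkin diagrams $A_n$ ($n\ge 1$), $D_n$ ($n\ge 4$), $E_6$, $E_7$, $E_8$. 2. $\max\Sigma_\Gamma=1/4$ if and only if $\Gamma$ is isomorphic to one of the extended Dynkin diagrams $\widetilde D_n$ ($n\ge 4$), $\widetilde E_6$, $\widetilde E_7$, $\widetilde E_8$. 3. If $\Gamma$ is neither one of the Dynkin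 diagrams in 1 nor one of the extended Dynkin diagrams in 2, then $\max\Sigma_\Gamma<1/4$. Here $A_n$ is the path with $n$ vertices; $D_n$ is obtained from the path with $n-1$ vertices by attaching one new leaf to the next-to-last vertex; $E_n$ ($n=6,7,8$) from the path with $n-1$ vertices by attaching one new leaf to the third vertex. $\widetilde D_n$ (with $n+1$ vertices) is obtained from the path with $n-1$ vertices by attaching one new leaf to the second vertex and another new leaf to the next-to-last vertex (both to the middle vertex if $n=4$); $\widetilde E_6$ consists of three paths with two edges each, glued at a common end vertex; $\widetilde E_7$ is the path with $7$ vertices with a new leaf attached to its middle vertex; $\widetilde E_8$ is the path with $8$ vertices with a new leaf attached to its third vertex. -/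

import Mathlib

open scoped ComplexConjugate

universe u w

namespace SubspaceConfig

section Algebra

variable {V : Type u}

/-- The defining relations of the algebra `A_{Γ,τ}` in the free complex algebra on the vertices:
`p_i² = p_i`; `p_i p_j p_i = τ p_i` for adjacent `i, j` (in both orders, since adjacency is
symmetric); and `p_i p_j = 0` for distinct non-adjacent `i, j` (also in both orders). -/
inductive Rel (Γ : SimpleGraph V) (τ : ℝ) : FreeAlgebra ℂ V → FreeAlgebra ℂ V → Prop
  | idem (i : V) : Rel Γ τ (FreeAlgebra.ι ℂ i * FreeAlgebra.ι ℂ i) (FreeAlgebra.ι ℂ i)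
  | adj (i j : V) (h : Γ.Adj i j) :
      Rel Γ τ (FreeAlgebra.ι ℂ i * FreeAlgebra.ι ℂ j * FreeAlgebra.ι ℂ i)
        ((τ : ℂ) • FreeAlgebra.ι ℂ i)
  | orth (i j : V) (hne : i ≠ j) (h : ¬ Γ.Adj i j) :
      Rel Γ τ (FreeAlgebra.ι ℂ i * FreeAlgebra.ι ℂ j) 0

/-- The unital complex algebra `A_{Γ,τ}` (its `*`-structure is put on it below). -/
def Alg (Γ : SimpleGraph V) (τ : ℝ) : Type u := RingQuot (Rel Γ τ)

variable (Γ : SimpleGraph V) (τ : ℝ)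

instance : Ring (Alg Γ τ) := inferInstanceAs (Ring (RingQuot (Rel Γ τ)))

instance : Algebra ℂ (Alg Γ τ) := inferInstanceAs (Algebra ℂ (RingQuot (Rel Γ τ)))

/-- The quotient map from the free algebra. -/
def mk : FreeAlgebra ℂ V →ₐ[ℂ] Alg Γ τ := RingQuot.mkAlgHom ℂ (Rel Γ τ)

/-- The generator `p_i` of `A_{Γ,τ}`. -/
def gen (i : V) : Alg Γ τ := mk Γ τ (FreeAlgebra.ι ℂ i)

variable {Γ τ}

theorem mk_surjective : Function.Surjective (mk Γ τ) := RingQuot.mkAlgHom_surjective ℂ _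

theorem mk_rel {x y : FreeAlgebra ℂ V} (h : Rel Γ τ x y) : mk Γ τ x = mk Γ τ y :=
  RingQuot.mkAlgHom_rel ℂ h

theorem gen_idem (i : V) : gen Γ τ i * gen Γ τ i = gen Γ τ i := by
  simpa [gen] using mk_rel (Rel.idem (Γ := Γ) (τ := τ) i)

theorem gen_adj {i j : V} (h : Γ.Adj i j) :
    gen Γ τ i * gen Γ τ j * gen Γ τ i = (τ : ℂ) • gen Γ τ i := by
  have := mk_rel (Rel.adj (τ := τ) i j h)
  rwa [map_mul, map_mul, map_smul] at this

theorem gen_orth {i j : V} (hne : i ≠ j) (h : ¬ Γ.Adj i j) : gen Γ τ i * gen Γ τ j = 0 := by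
  simpa [gen] using mk_rel (Rel.orth (τ := τ) i j hne h)

variable (Γ τ)

/-- The ring homomorphism from the free complex algebra on `V` to a ring `B` that sends the free
generator `i` to `f i` and the scalar `c` to `φ c`, for `φ` with central values. -/
noncomputable def liftRingHom {B : Type u} [Ring B] (φ : ℂ →+* B) (hφ : ∀ c x, φ c * x = x * φ c)
    (f : V → B) : FreeAlgebra ℂ V →+* B :=
  letI : Algebra ℂ B := φ.toAlgebra' hφ
  (FreeAlgebra.lift ℂ f : FreeAlgebra ℂ V →ₐ[ℂ] B).toRingHom

theorem liftRingHom_ι {B : Type u} [Ring B] (φ : ℂ →+* B) (hφ : ∀ c x, φ c * x = x * φ c)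
    (f : V → B) (i : V) : liftRingHom φ hφ f (FreeAlgebra.ι ℂ i) = f i :=
  letI : Algebra ℂ B := φ.toAlgebra' hφ
  FreeAlgebra.lift_ι_apply f i

theorem liftRingHom_algebraMap {B : Type u} [Ring B] (φ : ℂ →+* B)
    (hφ : ∀ c x, φ c * x = x * φ c) (f : V → B) (c : ℂ) :
    liftRingHom φ hφ f (algebraMap ℂ _ c) = φ c :=
  letI : Algebra ℂ B := φ.toAlgebra' hφ
  AlgHom.commutes (FreeAlgebra.lift ℂ f : FreeAlgebra ℂ V →ₐ[ℂ] B) c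

/-- The conjugate-linear ring homomorphism from the free algebra to the opposite of `A_{Γ,τ}` that
sends the free generator `i` to `p_i`. -/
noncomputable def preStar : FreeAlgebra ℂ V →+* (Alg Γ τ)ᵐᵒᵖ :=
  liftRingHom ((algebraMap ℂ (Alg Γ τ)ᵐᵒᵖ).comp (starRingEnd ℂ))
    (fun c x => Algebra.commutes (conj c) x) (fun i => MulOpposite.op (gen Γ τ i))

variable {Γ τ}

theorem preStar_ι (i : V) :
    preStar Γ τ (FreeAlgebra.ι ℂ i) = MulOpposite.op (gen Γ τ i) :=
  liftRingHom_ι _ _ _ i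

theorem preStar_algebraMap (c : ℂ) :
    preStar Γ τ (algebraMap ℂ _ c) = MulOpposite.op (algebraMap ℂ (Alg Γ τ) (conj c)) :=
  liftRingHom_algebraMap _ _ _ c

theorem preStar_rel {x y : FreeAlgebra ℂ V} (h : Rel Γ τ x y) :
    preStar Γ τ x = preStar Γ τ y := by
  cases h with
  | idem i => rw [map_mul, preStar_ι, ← MulOpposite.op_mul, gen_idem]
  | adj i j h =>
    rw [Algebra.smul_def, map_mul, map_mul, map_mul, preStar_algebraMap, preStar_ι, preStar_ι,
      ← MulOpposite.op_mul, ← MulOpposite.op_mul, ← MulOpposite.op_mul, ← mul_assoc, gen_adj h,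
      Complex.conj_ofReal, ← Algebra.commutes, Algebra.smul_def]
  | orth i j hne h =>
    rw [map_mul, map_zero, preStar_ι, preStar_ι, ← MulOpposite.op_mul,
      gen_orth hne.symm (fun h' => h h'.symm), MulOpposite.op_zero]

variable (Γ τ)

/-- The involution of `A_{Γ,τ}`, as a ring homomorphism to the opposite ring. -/
noncomputable def starHom : Alg Γ τ →+* (Alg Γ τ)ᵐᵒᵖ :=
  RingQuot.lift ⟨preStar Γ τ, fun _ _ h => preStar_rel h⟩

variable {Γ τ}

theorem starHom_mk (x : FreeAlgebra ℂ V) : starHom Γ τ (mk Γ τ x) = preStar Γ τ x := by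
  have h : mk Γ τ x = RingQuot.mkRingHom (Rel Γ τ) x :=
    congrArg (fun f : FreeAlgebra ℂ V →+* RingQuot (Rel Γ τ) => f x)
      (RingQuot.mkAlgHom_coe ℂ (Rel Γ τ))
  rw [h]
  exact RingQuot.lift_mkRingHom_apply (preStar Γ τ) (fun _ _ h => preStar_rel h) x

theorem starHom_gen (i : V) : starHom Γ τ (gen Γ τ i) = MulOpposite.op (gen Γ τ i) := by
  rw [gen, starHom_mk, preStar_ι, gen]

theorem starHom_algebraMap (c : ℂ) :
    starHom Γ τ (algebraMap ℂ _ c) = MulOpposite.op (algebraMap ℂ (Alg Γ τ) (conj c)) := by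
  rw [← AlgHom.commutes (mk Γ τ), starHom_mk, preStar_algebraMap]

theorem starHom_starHom (a : Alg Γ τ) : (starHom Γ τ (starHom Γ τ a).unop).unop = a := by
  obtain ⟨x, rfl⟩ := mk_surjective a
  induction x using FreeAlgebra.induction with
  | grade0 c =>
    rw [AlgHom.commutes, starHom_algebraMap, MulOpposite.unop_op, starHom_algebraMap,
      MulOpposite.unop_op, Complex.conj_conj]
  | grade1 i =>
    change (starHom Γ τ (starHom Γ τ (gen Γ τ i)).unop).unop = gen Γ τ i
    rw [starHom_gen, MulOpposite.unop_op, starHom_gen, MulOpposite.unop_op]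
  | mul a b ha hb => simp only [map_mul, MulOpposite.unop_mul, ha, hb]
  | add a b ha hb => simp only [map_add, MulOpposite.unop_add, ha, hb]

/-- The `*`-algebra structure of `A_{Γ,τ}`: the conjugate-linear involution that reverses products
and fixes every generator. -/
noncomputable instance : StarRing (Alg Γ τ) where
  star a := (starHom Γ τ a).unop
  star_involutive := starHom_starHom
  star_mul a b := by rw [map_mul, MulOpposite.unop_mul]
  star_add a b := by rw [map_add, MulOpposite.unop_add]

theorem star_gen (i : V) : star (gen Γ τ i) = gen Γ τ i := by
  change (starHom Γ τ (gen Γ τ i)).unop = _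
  rw [starHom_gen, MulOpposite.unop_op]

instance : StarModule ℂ (Alg Γ τ) where
  star_smul c a := by
    change (starHom Γ τ (c • a)).unop = conj c • (starHom Γ τ a).unop
    rw [Algebra.smul_def, map_mul, starHom_algebraMap, MulOpposite.unop_mul,
      MulOpposite.unop_op, ← Algebra.commutes, Algebra.smul_def]

end Algebra

/-- The set `Σ_Γ` of the parameters `0 < τ ≤ 1` for which `A_{Γ,τ}` has a nontrivial (unital)
`*`-representation by bounded operators on a complex Hilbert space. Nontrivial means that the
projections `p_i` are not all represented by `0`; the unital `*`-representation in which every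
`p_i` acts as `0` exists on every Hilbert space. -/
def sigmaSet {V : Type u} (Γ : SimpleGraph V) : Set ℝ :=
  {τ : ℝ | 0 < τ ∧ τ ≤ 1 ∧
    ∃ (H : Type w) (_ : NormedAddCommGroup H) (_ : InnerProductSpace ℂ H) (_ : CompleteSpace H)
      (π : Alg Γ τ →⋆ₐ[ℂ] (H →L[ℂ] H)), ∃ i : V, π (gen Γ τ i) ≠ 0}

/-- `D_n` (for `n ≥ 4`): the path `0 - 1 - ⋯ - (n-2)` and the vertex `n-1` joined to `n-3`. -/
def diagramD (n : ℕ) : SimpleGraph (Fin n) :=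
  SimpleGraph.fromRel fun i j =>
    (i.val + 1 = j.val ∧ j.val + 1 < n) ∨ (i.val + 3 = n ∧ j.val + 1 = n)

/-- The path `0 - 1 - ⋯ - (n-2)` and the vertex `n-1` joined to `2`. For `n = 6, 7, 8` this is
`E_n`, and for `n = 9` it is the extended diagram of `E_8`. -/
def diagramE (n : ℕ) : SimpleGraph (Fin n) :=
  SimpleGraph.fromRel fun i j =>
    (i.val + 1 = j.val ∧ j.val + 1 < n) ∨ (i.val = 2 ∧ j.val + 1 = n)

/-- The extended diagram of `D_n` (for `n ≥ 4`), with `n + 1` vertices: the path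
`0 - 1 - ⋯ - (n-2)`, the vertex `n-1` joined to `1` and the vertex `n` joined to `n-3`. -/
def diagramExtD (n : ℕ) : SimpleGraph (Fin (n + 1)) :=
  SimpleGraph.fromRel fun i j =>
    (i.val + 1 = j.val ∧ j.val + 1 < n) ∨ (i.val = 1 ∧ j.val + 1 = n) ∨
      (i.val + 3 = n ∧ j.val = n)

/-- The extended diagram of `E_6`: the path `0 - 1 - 2 - 3 - 4` and a second path `2 - 5 - 6`. -/
def diagramExtE6 : SimpleGraph (Fin 7) :=
  SimpleGraph.fromRel fun i j =>
    (i.val + 1 = j.val ∧ j.val ≤ 4) ∨ (i.val = 2 ∧ j.val = 5) ∨ (i.val = 5 ∧ j.val = 6)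

/-- The extended diagram of `E_7`: the path `0 - 1 - ⋯ - 6` and the vertex `7` joined to `3`. -/
def diagramExtE7 : SimpleGraph (Fin 8) :=
  SimpleGraph.fromRel fun i j =>
    (i.val + 1 = j.val ∧ j.val ≤ 6) ∨ (i.val = 3 ∧ j.val = 7)

/-- `Γ` is one of the Dynkin diagrams `A_n` (`n ≥ 1`), `D_n` (`n ≥ 4`), `E_6`, `E_7`, `E_8`. -/
def IsDynkin {V : Type u} (Γ : SimpleGraph V) : Prop :=
  (∃ n : ℕ, 1 ≤ n ∧ Nonempty (Γ ≃g SimpleGraph.pathGraph n)) ∨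
  (∃ n : ℕ, 4 ≤ n ∧ Nonempty (Γ ≃g diagramD n)) ∨
  Nonempty (Γ ≃g diagramE 6) ∨ Nonempty (Γ ≃g diagramE 7) ∨ Nonempty (Γ ≃g diagramE 8)

/-- `Γ` is one of the extended Dynkin diagrams of `D_n` (`n ≥ 4`), `E_6`, `E_7`, `E_8`. -/
def IsExtendedDynkin {V : Type u} (Γ : SimpleGraph V) : Prop :=
  (∃ n : ℕ, 4 ≤ n ∧ Nonempty (Γ ≃g diagramExtD n)) ∨
  Nonempty (Γ ≃g diagramExtE6) ∨ Nonempty (Γ ≃g diagramExtE7) ∨ Nonempty (Γ ≃g diagramE 9)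

end SubspaceConfig

open scoped SimpleGraph

namespace SubspaceConfig

/-! The question is spectral. With A the adjacency matrix, τ in (0,1] lies in Σ_Γ exactly when I −
√τ·A is positive semidefinite (`mem_sigmaSet_iff`). Given a nonzero P_r, choose a unit vector in its
range and carry it along the unique paths of the tree by rescaled projections; the vectors obtained
have Gram matrix I − √τ·A. Conversely, if this matrix is positive semidefinite it is a Gram matrix,
and the rank-one projections onto the vectors that realise it satisfy the relations. So max Σ_Γ is
decided by the largest eigenvalue λ of A, with 1/4 corresponding to λ = 2.

It remains to prove Smith's classification of trees by λ < 2, λ = 2, λ > 2. A positive weight c with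
Ac < 2c forces λ < 2, and one with Ac = 2c forces λ = 2; such weights are written down for the
Dynkin and the extended Dynkin diagrams. By induction on leaves, a tree that is not Dynkin contains
an extended diagram (`isDynkin_or_containsExtended`). If it is not equal to that diagram, the null
weight of the diagram, slightly enlarged, is a test vector showing λ > 2
(`nonempty_iso_or_lt_adjForm`). -/

open scoped Classical in
/-- The quadratic form `x ↦ ∑_{i ~ j} x_i x_j` (over ordered pairs) of the adjacency matrix. -/
noncomputable def adjForm {V : Type*} [Fintype V] (Γ : SimpleGraph V) (x : V → ℝ) : ℝ :=
  ∑ i, ∑ j, if Γ.Adj i j then x i * x j else 0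

/-! ### From a representation to the positivity of I − √τ·A -/

section Gram

variable {V : Type*} {H : Type*} [NormedAddCommGroup H] [InnerProductSpace ℂ H]

/-- Transport of a vector along a walk by rescaled projections with alternating sign. -/
noncomputable def transport {Γ : SimpleGraph V} (P : V → H →L[ℂ] H) (τ : ℝ) {r : V} (v : H) :
    {j : V} → Γ.Walk j r → H
  | _, .nil => v
  | j, .cons _ p => (-(√τ)⁻¹ : ℝ) • P j (transport P τ v p)

variable {Γ : SimpleGraph V} {P : V → H →L[ℂ] H} {τ : ℝ}

theorem apply_transport (hidem : ∀ i, P i * P i = P i) {r : V} {v : H} (hv : P r v = v) {j : V}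
    (p : Γ.Walk j r) : P j (transport P τ v p) = transport P τ v p := by
  cases p with
  | nil => exact hv
  | cons h p =>
    rw [transport, ContinuousLinearMap.map_smul_of_tower, ← mul_apply_eq_comp, hidem]

variable [CompleteSpace H]

theorem inner_apply_of_star_eq {T : H →L[ℂ] H} (h : star T = T) (x y : H) :
    inner ℂ (T x) y = inner ℂ x (T y) := by
  conv_lhs => rw [← h, ContinuousLinearMap.star_eq_adjoint, ContinuousLinearMap.adjoint_inner_left]

/-- The transported vector a is fixed by `P j`, so ⟨a, P_i a⟩ = ⟨a, P_j P_i P_j a⟩, and the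
adjacency relation applies. -/
theorem inner_transport_cons (hidem : ∀ i, P i * P i = P i)
    (hstar : ∀ i, star (P i) = P i)
    (hadj : ∀ i j, Γ.Adj i j → P i * P j * P i = (τ : ℂ) • P i)
    {r : V} {v : H} (hv : P r v = v) {i j : V} (h : Γ.Adj i j) (p : Γ.Walk j r) :
    inner ℂ (transport P τ v p) (P i (transport P τ v p)) =
      (τ : ℂ) * inner ℂ (transport P τ v p) (transport P τ v p) := by
  set a := transport P τ v p with ha
  have h1 : P j a = a := apply_transport hidem hv p
  have h2 : P j (P i (P j a)) = (τ : ℂ) • P j a := by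
    have := congrArg (fun T => T a) (hadj j i h.symm)
    simpa using this
  rw [h1] at h2
  calc inner ℂ a (P i a) = inner ℂ (P j a) (P i a) := by rw [h1]
    _ = inner ℂ a (P j (P i a)) := inner_apply_of_star_eq (hstar j) _ _
    _ = _ := by rw [h2, inner_smul_right]

theorem inner_transport_self (hτ : 0 < τ) (hidem : ∀ i, P i * P i = P i)
    (hstar : ∀ i, star (P i) = P i)
    (hadj : ∀ i j, Γ.Adj i j → P i * P j * P i = (τ : ℂ) • P i)
    {r : V} {v : H} (hv : P r v = v) (hv1 : ‖v‖ = 1) {j : V} (p : Γ.Walk j r) :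
    inner ℂ (transport P τ v p) (transport P τ v p) = (1 : ℂ) := by
  induction p with
  | nil => simp [transport, hv1]
  | @cons i j r h p ih =>
    have h1 := inner_transport_cons hidem hstar hadj hv h p
    rw [ih hv] at h1
    have hs : ((√τ : ℝ) : ℂ) * (√τ : ℝ) = τ := by
      rw [← Complex.ofReal_mul, Real.mul_self_sqrt hτ.le]
    have hs0 : ((√τ : ℝ) : ℂ) ≠ 0 := by
      simpa using (Real.sqrt_pos.2 hτ).ne'
    rw [transport, inner_smul_left_eq_star_smul, inner_smul_right_eq_smul,
      inner_apply_of_star_eq (hstar i), ← mul_apply_eq_comp, hidem, h1, ← hs]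
    simp
    field_simp

theorem inner_transport_adj (hτ : 0 < τ) (hidem : ∀ i, P i * P i = P i)
    (hstar : ∀ i, star (P i) = P i)
    (hadj : ∀ i j, Γ.Adj i j → P i * P j * P i = (τ : ℂ) • P i)
    {r : V} {v : H} (hv : P r v = v) (hv1 : ‖v‖ = 1) {i j : V} (h : Γ.Adj i j)
    (p : Γ.Walk j r) :
    inner ℂ (transport P τ v p) (transport P τ v (SimpleGraph.Walk.cons h p)) =
      ((-√τ : ℝ) : ℂ) := by
  have h1 := inner_transport_cons hidem hstar hadj hv h p
  rw [inner_transport_self hτ hidem hstar hadj hv hv1] at h1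
  have hs : ((√τ : ℝ) : ℂ) * (√τ : ℝ) = τ := by
    rw [← Complex.ofReal_mul, Real.mul_self_sqrt hτ.le]
  have hs0 : ((√τ : ℝ) : ℂ) ≠ 0 := by
    simpa using (Real.sqrt_pos.2 hτ).ne'
  rw [transport, inner_smul_right_eq_smul, h1, ← hs]
  simp
  field_simp

/-- The squared norm of ∑ x_j b_j is nonnegative, where b_j is transported along the path from j to
r. The minus sign in `transport` makes adjacent inner products −√τ, so this norm is exactly the
difference of the two sides. -/
theorem adjForm_le_of_projections [Fintype V] (hΓ : Γ.IsTree) (hτ : 0 < τ)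
    (hidem : ∀ i, P i * P i = P i) (hstar : ∀ i, star (P i) = P i)
    (hadj : ∀ i j, Γ.Adj i j → P i * P j * P i = (τ : ℂ) • P i)
    (horth : ∀ i j, i ≠ j → ¬ Γ.Adj i j → P i * P j = 0)
    {r : V} (hr : P r ≠ 0) (x : V → ℝ) : √τ * adjForm Γ x ≤ ∑ i, x i ^ 2 := by
  classical
  obtain ⟨v, hv, hv1⟩ : ∃ v : H, P r v = v ∧ ‖v‖ = 1 := by
    obtain ⟨a, ha⟩ : ∃ a, P r a ≠ 0 := by
      by_contra! h
      exact hr (ContinuousLinearMap.ext h)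
    refine ⟨((‖P r a‖⁻¹ : ℝ) : ℂ) • P r a, ?_, ?_⟩
    · rw [map_smul, ← mul_apply_eq_comp, hidem]
    · rw [norm_smul]
      simp [ha]
  choose p hp _ using fun j => hΓ.existsUnique_path j r
  set b : V → H := fun j => transport P τ v (p j) with hb
  have key : ∀ i j, Γ.Adj i j → i ∉ (p j).support → inner ℂ (b j) (b i) = ((-√τ : ℝ) : ℂ) := by
    intro i j h hi
    have : p i = SimpleGraph.Walk.cons h (p j) :=
      congrArg Subtype.val ((hΓ.isAcyclic.subsingleton_path i r).elim ⟨p i, hp i⟩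
        ⟨_, (hp j).cons hi⟩)
    simp only [hb]
    rw [this]
    exact inner_transport_adj hτ hidem hstar hadj hv hv1 h (p j)
  have hinner : ∀ i j, inner ℂ (b i) (b j) =
      (((if i = j then 1 else 0) - √τ * (if Γ.Adj i j then 1 else 0) : ℝ) : ℂ) := by
    intro i j
    by_cases hij : i = j
    · subst hij
      simp only [hb, inner_transport_self hτ hidem hstar hadj hv hv1]
      simp
    by_cases h : Γ.Adj i j
    -- In a tree the two ends of an edge cannot each lie on the other's path to r, so one path is
    -- the other with this edge prepended. Reversal gives both paths the common starting point r.
    · have hcase : i ∉ (p j).support ∨ j ∉ (p i).support := by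
        by_contra! hc
        have hr' : ∀ k, (p k).reverse.IsPath := fun k => (hp k).reverse
        exact hΓ.isAcyclic.ne_mem_support_of_support_of_adj_of_isPath (hr' i) (hr' j) h
          (by simpa using hc.2) (by simpa using hc.1)
      rcases hcase with hc | hc
      · rw [← inner_conj_symm, key i j h hc]
        simp [hij, h]
      · rw [key j i h.symm hc]
        simp [hij, h]
    · have h1 : P i (b i) = b i := apply_transport hidem hv (p i)
      have h2 : P j (b j) = b j := apply_transport hidem hv (p j)
      rw [← h1, ← h2, inner_apply_of_star_eq (hstar i), ← mul_apply_eq_comp,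
        horth i j hij h]
      simp [hij, h]
  have hnn : 0 ≤ RCLike.re (inner ℂ (∑ i, (x i : ℂ) • b i) (∑ i, (x i : ℂ) • b i)) :=
    inner_self_nonneg
  have hsum : inner ℂ (∑ i, (x i : ℂ) • b i) (∑ i, (x i : ℂ) • b i) =
      ((∑ i, x i ^ 2 - √τ * adjForm Γ x : ℝ) : ℂ) := by
    simp only [sum_inner, inner_sum, inner_smul_left, inner_smul_right, hinner, adjForm,
      Complex.conj_ofReal]
    rw [show ∑ i, x i ^ 2 = ∑ i, ∑ j, if i = j then x i * x j else 0 by simp [sq],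
      Finset.mul_sum, ← Finset.sum_sub_distrib]
    simp only [Finset.mul_sum, Complex.ofReal_sum]
    rw [Finset.sum_comm]
    refine Finset.sum_congr rfl fun i _ => ?_
    rw [← Finset.sum_sub_distrib, Complex.ofReal_sum]
    refine Finset.sum_congr rfl fun j _ => ?_
    split_ifs <;> push_cast <;> ring
  rw [hsum] at hnn
  simp only [RCLike.re_to_complex, Complex.ofReal_re] at hnn
  linarith

end Gram

/-! ### From positivity to a representation -/

section Converse

variable {V : Type u} {Γ : SimpleGraph V} {τ : ℝ}

theorem exists_vectors_of_adjForm_le [Fintype V] (hx : ∀ x, √τ * adjForm Γ x ≤ ∑ i, x i ^ 2) :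
    ∃ (m : ℕ) (b : V → EuclideanSpace ℂ (ULift.{w} (Fin m))), ∀ i j, inner ℂ (b i) (b j) =
      open scoped Classical in
      (((if i = j then 1 else 0) - √τ * (if Γ.Adj i j then 1 else 0) : ℝ) : ℂ) := by
  classical
  let M : Matrix V V ℝ := fun i j =>
    (if i = j then 1 else 0) - √τ * (if Γ.Adj i j then 1 else 0)
  have hM : M.PosSemidef := by
    refine Matrix.PosSemidef.of_dotProduct_mulVec_nonneg ?_ fun x => ?_
    · ext i j
      change M j i = M i j
      simp only [M, Γ.adj_comm j i, eq_comm (a := j)]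
    · have h1 : star x ⬝ᵥ Matrix.mulVec M x = ∑ i, x i ^ 2 - √τ * adjForm Γ x := by
        simp only [dotProduct, Matrix.mulVec, adjForm, M, Pi.star_apply, star_trivial]
        rw [show ∑ i, x i ^ 2 = ∑ i, ∑ j, if i = j then x i * x j else 0 by simp [sq],
          Finset.mul_sum, ← Finset.sum_sub_distrib]
        refine Finset.sum_congr rfl fun i _ => ?_
        rw [Finset.mul_sum, Finset.mul_sum, ← Finset.sum_sub_distrib]
        refine Finset.sum_congr rfl fun j _ => ?_
        split_ifs <;> ring
      rw [h1]
      linarith [hx x]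
  obtain ⟨m, v, hv⟩ := Matrix.posSemidef_iff_eq_sum_vecMulVec.1 hM
  -- The vectors have real coordinates, so conjugation does nothing; `ULift` only moves the space to
  -- universe `w`.
  refine ⟨m, fun i => WithLp.toLp 2 fun k => (v k.down i : ℂ), fun i j => ?_⟩
  have hij := congrFun (congrFun hv i) j
  simp only [M] at hij
  rw [hij, Matrix.sum_apply, PiLp.inner_apply, ← Equiv.ulift.{w}.symm.sum_comp]
  push_cast
  refine Finset.sum_congr rfl fun k _ => ?_
  simp [Matrix.vecMulVec_apply, mul_comm]

theorem mem_sigmaSet_of_projections {H : Type w} [NormedAddCommGroup H] [InnerProductSpace ℂ H]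
    [CompleteSpace H] (h0 : 0 < τ) (h1 : τ ≤ 1) (P : V → H →L[ℂ] H)
    (hidem : ∀ i, P i * P i = P i) (hstar : ∀ i, star (P i) = P i)
    (hadj : ∀ i j, Γ.Adj i j → P i * P j * P i = (τ : ℂ) • P i)
    (horth : ∀ i j, i ≠ j → ¬ Γ.Adj i j → P i * P j = 0) {r : V} (hr : P r ≠ 0) :
    τ ∈ sigmaSet.{u, w} Γ := by
  have hrel : ∀ ⦃x y⦄, Rel Γ τ x y → FreeAlgebra.lift ℂ P x = FreeAlgebra.lift ℂ P y := by
    intro x y hxy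
    cases hxy with
    | idem i => simpa using hidem i
    | adj i j h =>
      simp only [map_mul, map_smul, FreeAlgebra.lift_ι_apply]
      exact hadj i j h
    | orth i j hne h => simpa using horth i j hne h
  let π₀ : Alg Γ τ →ₐ[ℂ] (H →L[ℂ] H) := RingQuot.liftAlgHom ℂ ⟨FreeAlgebra.lift ℂ P, hrel⟩
  have hπ₀ : ∀ x, π₀ (mk Γ τ x) = FreeAlgebra.lift ℂ P x :=
    fun x => RingQuot.liftAlgHom_mkAlgHom_apply ℂ _ hrel x
  clear_value π₀
  have hgen : ∀ i, π₀ (gen Γ τ i) = P i := fun i => by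
    rw [gen, hπ₀, FreeAlgebra.lift_ι_apply]
  have hπ₀star : ∀ a, π₀ (star a) = star (π₀ a) := by
    intro a
    obtain ⟨x, rfl⟩ := mk_surjective a
    induction x using FreeAlgebra.induction with
    | grade0 c =>
      rw [AlgHom.commutes, ← algebraMap_star_comm, AlgHom.commutes, AlgHom.commutes,
        algebraMap_star_comm]
    | grade1 i =>
      change π₀ (star (gen Γ τ i)) = star (π₀ (gen Γ τ i))
      rw [star_gen, hgen, hstar]
    | mul a b ha hb => simp only [map_mul, star_mul, ha, hb]
    | add a b ha hb => simp only [map_add, star_add, ha, hb]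
  refine ⟨h0, h1, H, inferInstance, inferInstance, inferInstance,
    { π₀ with map_star' := hπ₀star }, r, ?_⟩
  change π₀ (gen Γ τ r) ≠ 0
  rwa [hgen]

/-- The rank-one projections onto unit vectors b_i work: P_i P_j P_i = |⟨b_i, b_j⟩|² P_i, and the
Gram entry ∓√τ squares to τ. -/
theorem mem_sigmaSet_of_adjForm_le [Fintype V] [Nonempty V] (h0 : 0 < τ) (h1 : τ ≤ 1)
    (hx : ∀ x, √τ * adjForm Γ x ≤ ∑ i, x i ^ 2) : τ ∈ sigmaSet.{u, w} Γ := by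
  classical
  obtain ⟨m, b, hb⟩ := exists_vectors_of_adjForm_le.{u, w} hx
  have hb1 : ∀ i, ‖b i‖ = 1 := fun i => by
    have := hb i i
    simp only [SimpleGraph.irrefl, if_true, if_false, mul_zero, sub_zero,
      Complex.ofReal_one] at this
    rw [inner_self_eq_norm_sq_to_K] at this
    have h2 : ‖b i‖ ^ 2 = 1 := by
      apply Complex.ofReal_injective
      push_cast
      exact this
    nlinarith [norm_nonneg (b i)]
  set P := fun i => InnerProductSpace.rankOne ℂ (b i) (b i)
  have hP : ∀ i, IsStarProjection (P i) :=
    fun i => InnerProductSpace.isStarProjection_rankOne_self (hb1 i)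
  have hmul : ∀ i j, P i * P j = inner ℂ (b i) (b j) • InnerProductSpace.rankOne ℂ (b i) (b j) :=
    fun i j => InnerProductSpace.rankOne_comp_rankOne _ _ _ _
  have hadj : ∀ i j, Γ.Adj i j → P i * P j * P i = (τ : ℂ) • P i := by
    intro i j h
    have hij : inner ℂ (b i) (b j) = -((√τ : ℝ) : ℂ) := by rw [hb]; simp [h, h.ne]
    have hji : inner ℂ (b j) (b i) = -((√τ : ℝ) : ℂ) := by rw [hb]; simp [h.symm, h.ne']
    have hs : ((√τ : ℝ) : ℂ) * (√τ : ℝ) = τ := by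
      rw [← Complex.ofReal_mul, Real.mul_self_sqrt h0.le]
    have h3 : InnerProductSpace.rankOne ℂ (b i) (b j) * P i = inner ℂ (b j) (b i) • P i :=
      InnerProductSpace.rankOne_comp_rankOne _ _ _ _
    rw [hmul, smul_mul_assoc, h3, smul_smul, hij, hji, neg_mul_neg, hs]
  have horth : ∀ i j, i ≠ j → ¬ Γ.Adj i j → P i * P j = 0 := by
    intro i j hne h
    rw [hmul, hb]
    simp [hne, h]
  have hne : b (Classical.arbitrary V) ≠ 0 := by
    rw [← norm_ne_zero_iff, hb1]
    exact one_ne_zero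
  exact mem_sigmaSet_of_projections h0 h1 P (fun i => (hP i).isIdempotentElem.eq)
    (fun i => (hP i).isSelfAdjoint.star_eq) hadj horth
    (InnerProductSpace.rankOne_ne_zero hne hne)

theorem mem_sigmaSet_iff [Fintype V] (hΓ : Γ.IsTree) : τ ∈ sigmaSet.{u, w} Γ ↔
    0 < τ ∧ τ ≤ 1 ∧ ∀ x, √τ * adjForm Γ x ≤ ∑ i, x i ^ 2 := by
  constructor
  · rintro ⟨h0, h1, H, _, _, _, π, r, hr⟩
    refine ⟨h0, h1, fun x => adjForm_le_of_projections (P := fun i => π (gen Γ τ i)) hΓ h0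
      (fun i => ?_) (fun i => ?_) (fun i j h => ?_) (fun i j hne h => ?_) hr x⟩
    · rw [← map_mul, gen_idem]
    · rw [← map_star, star_gen]
    · rw [← map_mul, ← map_mul, gen_adj h, map_smul]
    · rw [← map_mul, gen_orth hne h, map_zero]
  · rintro ⟨h0, h1, hx⟩
    have := hΓ.connected.nonempty
    exact mem_sigmaSet_of_adjForm_le h0 h1 hx

end Converse

/-! ### Eigenvalue bounds from positive weights -/

section Weights

variable {V : Type*} [Fintype V] {Γ : SimpleGraph V}

open scoped Classical in
/-- The sum of a weight function over the neighbours of a vertex. -/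
noncomputable def neighborSum (Γ : SimpleGraph V) (c : V → ℝ) (i : V) : ℝ :=
  ∑ j, if Γ.Adj i j then c j else 0

theorem adjForm_eq_sum_mul_neighborSum (x : V → ℝ) :
    adjForm Γ x = ∑ i, x i * neighborSum Γ x i := by
  simp [adjForm, neighborSum, Finset.mul_sum]

/-- Schur's test: bound each x_i x_j by (c_j/c_i · x_i² + c_i/c_j · x_j²)/2 and collect the terms at
each vertex. -/
theorem adjForm_le_of_neighborSum_le {c : V → ℝ} {l : ℝ} (hc : ∀ i, 0 < c i)
    (h : ∀ i, neighborSum Γ c i ≤ l * c i) (x : V → ℝ) : adjForm Γ x ≤ l * ∑ i, x i ^ 2 := by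
  classical
  have h1 : adjForm Γ x ≤ ∑ i, ∑ j, ((if Γ.Adj i j then c j / c i * x i ^ 2 / 2 else 0) +
      (if Γ.Adj j i then c i / c j * x j ^ 2 / 2 else 0)) := by
    refine Finset.sum_le_sum fun i _ => Finset.sum_le_sum fun j _ => ?_
    simp only [Γ.adj_comm j i]
    split_ifs
    · have hi := hc i
      have hj := hc j
      have : c j / c i * x i ^ 2 / 2 + c i / c j * x j ^ 2 / 2 - x i * x j =
          (c j * x i - c i * x j) ^ 2 / (2 * c i * c j) := by
        field_simp
        ring
      have h3 : 0 ≤ (c j * x i - c i * x j) ^ 2 / (2 * c i * c j) := by positivity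
      linarith
    · simp
  refine h1.trans ?_
  simp only [Finset.sum_add_distrib]
  rw [Finset.sum_comm (f := fun i j => if Γ.Adj j i then c i / c j * x j ^ 2 / 2 else 0),
    ← two_mul, Finset.mul_sum, Finset.mul_sum]
  refine Finset.sum_le_sum fun i _ => ?_
  have h2 : ∑ j, (if Γ.Adj i j then c j / c i * x i ^ 2 / 2 else 0) =
      neighborSum Γ c i * (x i ^ 2 / (2 * c i)) := by
    rw [neighborSum, Finset.sum_mul]
    refine Finset.sum_congr rfl fun j _ => ?_
    have := (hc i).ne'
    split_ifs
    · field_simp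
    · simp
  rw [h2]
  have hi := hc i
  calc 2 * (neighborSum Γ c i * (x i ^ 2 / (2 * c i)))
      ≤ 2 * ((l * c i) * (x i ^ 2 / (2 * c i))) := by
        have := h i
        gcongr
    _ = l * x i ^ 2 := by field_simp

/-- Finitely many ratios below 2 have a maximum below 2. The bound 1 ≤ l is kept so that τ = 1/l²
respects τ ≤ 1. -/
theorem exists_lt_two_of_neighborSum_lt {c : V → ℝ} (hc : ∀ i, 0 < c i)
    (h : ∀ i, neighborSum Γ c i < 2 * c i) :
    ∃ l : ℝ, 1 ≤ l ∧ l < 2 ∧ ∀ i, neighborSum Γ c i ≤ l * c i := by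
  classical
  cases isEmpty_or_nonempty V with
  | inl hV => exact ⟨1, le_rfl, by norm_num, fun i => isEmptyElim i⟩
  | inr hV =>
    obtain ⟨k, -, hk⟩ := Finset.exists_max_image Finset.univ
      (fun i => neighborSum Γ c i / c i) Finset.univ_nonempty
    refine ⟨max 1 (neighborSum Γ c k / c k), le_max_left _ _,
      max_lt (by norm_num) ((div_lt_iff₀ (hc k)).2 (h k)), fun i => ?_⟩
    rw [← div_le_iff₀ (hc i)]
    exact (hk i (Finset.mem_univ i)).trans (le_max_right _ _)

theorem adjForm_le_card_mul (x : V → ℝ) :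
    adjForm Γ x ≤ (Fintype.card V : ℝ) * ∑ i, x i ^ 2 := by
  classical
  refine adjForm_le_of_neighborSum_le (c := fun _ => 1) (fun _ => one_pos) (fun i => ?_) x
  calc neighborSum Γ (fun _ => 1) i ≤ ∑ _j : V, (1 : ℝ) := by
        refine Finset.sum_le_sum fun j _ => ?_
        split_ifs <;> norm_num
    _ = _ := by simp

theorem neighborSum_comp_iso {W : Type*} [Fintype W] {G : SimpleGraph W} (e : Γ ≃g G)
    (c : W → ℝ) (i : V) : neighborSum Γ (c ∘ e) i = neighborSum G c (e i) := by
  classical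
  rw [neighborSum, neighborSum, ← e.toEquiv.sum_comp]
  refine Finset.sum_congr rfl fun j _ => ?_
  have : G.Adj (e i) (e.toEquiv j) ↔ Γ.Adj i j := e.map_adj_iff
  simp only [this]
  rfl

theorem neighborSum_natCast [DecidableRel Γ.Adj] (c : V → ℕ) (i : V) :
    neighborSum Γ (fun j => (c j : ℝ)) i = ((∑ j, if Γ.Adj i j then c j else 0 : ℕ) : ℝ) := by
  rw [neighborSum]
  push_cast
  refine Finset.sum_congr rfl fun j _ => ?_
  split_ifs <;> rfl

/-- Once the neighbours are listed as an explicit set of natural numbers, adjacency in the infinite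
families can be checked by `omega`. -/
theorem neighborSum_fin {n : ℕ} (G : SimpleGraph (Fin n)) (c : ℕ → ℝ) (i : Fin n) (S : Finset ℕ)
    (hS : ∀ j ∈ S, j < n) (h : ∀ j : Fin n, G.Adj i j ↔ (j : ℕ) ∈ S) :
    neighborSum G (fun j => c j) i = ∑ j ∈ S, c j := by
  classical
  simp only [neighborSum, h]
  rw [Fin.sum_univ_eq_sum_range (fun j => if j ∈ S then c j else 0), ← Finset.sum_filter]
  congr 1
  ext j
  simp only [Finset.mem_filter, Finset.mem_range]
  exact ⟨fun h => h.2, fun h => ⟨hS j h, h⟩⟩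

end Weights

/-! ### Existence of the maximum and its comparison with 1/4 -/

section Extremal

variable {V : Type u} [Fintype V] {Γ : SimpleGraph V}

theorem exists_isGreatest_sigmaSet (hΓ : Γ.IsTree) : ∃ m, IsGreatest (sigmaSet.{u, w} Γ) m := by
  have := hΓ.connected.nonempty
  set N : ℝ := (Fintype.card V : ℝ) with hN
  have hN1 : 1 ≤ N := Nat.one_le_cast.2 Fintype.card_pos
  have hmem : 1 / N ^ 2 ∈ sigmaSet.{u, w} Γ := by
    refine (mem_sigmaSet_iff hΓ).2 ⟨by positivity, ?_, fun x => ?_⟩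
    · rw [div_le_one (by positivity)]
      nlinarith
    · rw [Real.sqrt_div zero_le_one, Real.sqrt_one, Real.sqrt_sq (by linarith), one_div,
        inv_mul_le_iff₀ (by linarith)]
      exact adjForm_le_card_mul x
  -- Cutting at a known element of Σ_Γ keeps away from the excluded value 0, so the closed
  -- conditions define a compact set.
  let K : Set ℝ := Set.Icc (1 / N ^ 2) 1 ∩ {τ | ∀ x, √τ * adjForm Γ x ≤ ∑ i, x i ^ 2}
  have hK : IsCompact K := by
    refine isCompact_Icc.inter_right ?_
    rw [Set.ofPred_forall]
    exact isClosed_iInter fun x => isClosed_le (by fun_prop) continuous_const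
  have hNK : 1 / N ^ 2 ∈ K := by
    obtain ⟨-, h1, h2⟩ := (mem_sigmaSet_iff hΓ).1 hmem
    exact ⟨⟨le_rfl, h1⟩, h2⟩
  obtain ⟨m, hm, hmax⟩ := hK.exists_isGreatest ⟨_, hNK⟩
  refine ⟨m, (mem_sigmaSet_iff hΓ).2 ⟨lt_of_lt_of_le (by positivity) hm.1.1, hm.1.2, hm.2⟩,
    fun τ hτ => ?_⟩
  obtain ⟨h0, h1, h2⟩ := (mem_sigmaSet_iff hΓ).1 hτ
  by_cases hτN : 1 / N ^ 2 ≤ τ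
  · exact hmax ⟨⟨hτN, h1⟩, h2⟩
  · exact (not_le.1 hτN).le.trans (hmax hNK)

variable {m : ℝ}

theorem one_div_sq_le_of_isGreatest (hΓ : Γ.IsTree) (hm : IsGreatest (sigmaSet.{u, w} Γ) m)
    {l : ℝ} (hl : 1 ≤ l) (h : ∀ x, adjForm Γ x ≤ l * ∑ i, x i ^ 2) : 1 / l ^ 2 ≤ m := by
  refine hm.2 ((mem_sigmaSet_iff hΓ).2 ⟨by positivity, ?_, fun x => ?_⟩)
  · rw [div_le_one (by positivity)]
    nlinarith
  · rw [Real.sqrt_div zero_le_one, Real.sqrt_one, Real.sqrt_sq (by linarith), one_div,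
      inv_mul_le_iff₀ (by linarith)]
    exact h x

theorem one_fourth_lt_of_weight (hΓ : Γ.IsTree) (hm : IsGreatest (sigmaSet.{u, w} Γ) m)
    {c : V → ℝ} (hc : ∀ i, 0 < c i) (h : ∀ i, neighborSum Γ c i < 2 * c i) : 1 / 4 < m := by
  obtain ⟨l, hl1, hl2, hl⟩ := exists_lt_two_of_neighborSum_lt hc h
  refine lt_of_lt_of_le ?_
    (one_div_sq_le_of_isGreatest hΓ hm hl1 (adjForm_le_of_neighborSum_le hc hl))
  exact one_div_lt_one_div_of_lt (by positivity) (by nlinarith)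

theorem lt_one_fourth_of_lt_adjForm (hΓ : Γ.IsTree) (hm : IsGreatest (sigmaSet.{u, w} Γ) m)
    {x : V → ℝ} (hx : 2 * ∑ i, x i ^ 2 < adjForm Γ x) : m < 1 / 4 := by
  obtain ⟨h0, -, h⟩ := (mem_sigmaSet_iff hΓ).1 hm.1
  have h1 := h x
  have hs : 0 ≤ ∑ i, x i ^ 2 := Finset.sum_nonneg fun i _ => sq_nonneg _
  by_contra! h4
  have h2 : 1 / 2 ≤ √m := Real.le_sqrt_of_sq_le (by linarith)
  nlinarith

/-- The weight is used twice: as a test vector with Rayleigh quotient 2 for the upper bound, and in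
Schur's test for the lower bound. -/
theorem eq_one_fourth_of_weight (hΓ : Γ.IsTree) (hm : IsGreatest (sigmaSet.{u, w} Γ) m)
    {c : V → ℝ} (hc : ∀ i, 0 < c i) (h : ∀ i, neighborSum Γ c i = 2 * c i) : m = 1 / 4 := by
  have := hΓ.connected.nonempty
  refine le_antisymm ?_ ?_
  · obtain ⟨h0, -, h'⟩ := (mem_sigmaSet_iff hΓ).1 hm.1
    have h1 := h' c
    have hs : 0 < ∑ i, c i ^ 2 :=
      Finset.sum_pos (fun i _ => pow_pos (hc i) 2) Finset.univ_nonempty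
    have h2 : adjForm Γ c = 2 * ∑ i, c i ^ 2 := by
      rw [adjForm_eq_sum_mul_neighborSum, Finset.mul_sum]
      exact Finset.sum_congr rfl fun i _ => by rw [h]; ring
    rw [h2] at h1
    have h3 : √m ≤ 1 / 2 := by
      by_contra! hlt
      nlinarith
    rw [Real.sqrt_le_left (by norm_num)] at h3
    linarith
  · have := one_div_sq_le_of_isGreatest hΓ hm (l := 2) (by norm_num)
      (adjForm_le_of_neighborSum_le hc fun i => (h i).le)
    linarith

end Extremal

/-! ### Explicit weights on the diagrams -/

section Diagrams

theorem exists_weight_pathGraph (n : ℕ) : ∃ c : Fin n → ℝ, (∀ i, 0 < c i) ∧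
    ∀ i, neighborSum (SimpleGraph.pathGraph n) c i < 2 * c i := by
  -- The solution of 2c − Ac = 2, that is, the coefficients of the sum of the positive roots. It
  -- vanishes at the phantom vertices −1 and n, so the end vertices need no correction.
  let c : ℕ → ℝ := fun j => ((j : ℝ) + 1) * ((n : ℝ) - j)
  refine ⟨fun i => c i, fun i => ?_, fun i => ?_⟩
  · have : ((i : ℕ) : ℝ) + 1 ≤ n := by exact_mod_cast i.2
    exact mul_pos (by positivity) (by linarith)
  · obtain ⟨i, hi⟩ := i
    have key : ∀ S : Finset ℕ, (∀ j ∈ S, j < n) →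
        (∀ j : Fin n, (i + 1 = j ∨ (j : ℕ) + 1 = i) ↔ (j : ℕ) ∈ S) →
        ∑ j ∈ S, c j < 2 * c i →
        neighborSum (SimpleGraph.pathGraph n) (fun i => c i) ⟨i, hi⟩ < 2 * c i := by
      intro S h1 h2 h3
      rwa [neighborSum_fin _ c _ S h1 fun j => by rw [SimpleGraph.pathGraph_adj, ← h2]]
    obtain ⟨l, rfl⟩ : ∃ l, n = i + 1 + l := ⟨n - (i + 1), by omega⟩
    rcases i with _ | k <;> rcases l with _ | l
    · exact key ∅ (by simp) (fun j => by have := j.2; simp) (by simp [c])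
    · refine key {1} (by simp only [Finset.mem_singleton]; omega)
        (fun j => by have := j.2; simp only [Finset.mem_singleton]; omega) ?_
      rw [Finset.sum_singleton]
      simp only [c]
      push_cast
      linarith
    · refine key {k} (by simp only [Finset.mem_singleton]; omega)
        (fun j => by have := j.2; simp only [Finset.mem_singleton]; omega) ?_
      rw [Finset.sum_singleton]
      simp only [c]
      push_cast
      linarith
    · refine key {k, k + 2} (by simp only [Finset.mem_insert, Finset.mem_singleton]; omega)
        (fun j => by have := j.2; simp only [Finset.mem_insert, Finset.mem_singleton]; omega) ?_
      rw [Finset.sum_pair (by omega)]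
      simp only [c]
      push_cast
      linarith

theorem exists_weight_diagramD {n : ℕ} (hn : 4 ≤ n) : ∃ c : Fin n → ℝ, (∀ i, 0 < c i) ∧
    ∀ i, neighborSum (diagramD n) c i < 2 * c i := by
  -- Twice the coefficients of the sum of the positive roots, so 2c − Ac = 4; doubling avoids halves
  -- on the two fork leaves n−2 and n−1.
  let c : ℕ → ℝ := fun j =>
    if j + 3 ≤ n then 2 * (((j : ℝ) + 1) * (2 * (n : ℝ) - j - 2)) else (n : ℝ) * (n - 1)
  have hn' : (4 : ℝ) ≤ n := by exact_mod_cast hn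
  refine ⟨fun i => c i, fun i => ?_, fun i => ?_⟩
  · simp only [c]
    split_ifs with h
    · have : ((i : ℕ) : ℝ) + 3 ≤ n := by exact_mod_cast h
      exact mul_pos two_pos (mul_pos (by positivity) (by linarith))
    · exact mul_pos (by linarith) (by linarith)
  · obtain ⟨i, hi⟩ := i
    have key : ∀ S : Finset ℕ, (∀ j ∈ S, j < n) →
        (∀ j : Fin n, (i ≠ j ∧ (((i + 1 = j ∧ (j : ℕ) + 1 < n) ∨ (i + 3 = n ∧ (j : ℕ) + 1 = n)) ∨
          (((j : ℕ) + 1 = i ∧ i + 1 < n) ∨ ((j : ℕ) + 3 = n ∧ i + 1 = n)))) ↔ (j : ℕ) ∈ S) →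
        ∑ j ∈ S, c j < 2 * c i →
        neighborSum (diagramD n) (fun i => c i) ⟨i, hi⟩ < 2 * c i := by
      intro S h1 h2 h3
      rwa [neighborSum_fin _ c _ S h1 fun j => by
        rw [diagramD, SimpleGraph.fromRel_adj, ← h2, ne_eq, Fin.ext_iff]]
    have cl : ∀ j, j + 3 ≤ n → c j = 2 * (((j : ℝ) + 1) * (2 * (n : ℝ) - j - 2)) :=
      fun j hj => if_pos hj
    have cr : ∀ j, ¬ j + 3 ≤ n → c j = (n : ℝ) * (n - 1) := fun j hj => if_neg hj
    clear_value c
    rcases lt_trichotomy (i + 3) n with h | h | h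
    · rcases i with _ | k
      · refine key {1} (by simp only [Finset.mem_singleton]; omega)
          (fun j => by have := j.2; simp only [Finset.mem_singleton]; omega) ?_
        rw [Finset.sum_singleton, cl _ (by omega), cl _ (by omega)]
        push_cast
        linarith
      · refine key {k, k + 2} (by simp only [Finset.mem_insert, Finset.mem_singleton]; omega)
          (fun j => by have := j.2; simp only [Finset.mem_insert, Finset.mem_singleton]; omega) ?_
        rw [Finset.sum_pair (by omega), cl _ (by omega), cl _ (by omega), cl _ (by omega)]
        push_cast
        linarith
    · obtain ⟨k, rfl⟩ : ∃ k, i = k + 1 := ⟨i - 1, by omega⟩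
      obtain rfl : n = k + 4 := by omega
      refine key {k, k + 2, k + 3} (by simp only [Finset.mem_insert, Finset.mem_singleton]; omega)
        (fun j => by have := j.2; simp only [Finset.mem_insert, Finset.mem_singleton, true_and]; omega) ?_
      rw [Finset.sum_insert (by simp only [Finset.mem_insert, Finset.mem_singleton]; omega), Finset.sum_pair (by omega), cl k (by omega),
        cl (k + 1) (by omega), cr (k + 2) (by omega), cr (k + 3) (by omega)]
      push_cast
      linarith
    · obtain ⟨k, rfl⟩ : ∃ k, n = k + 4 := ⟨n - 4, by omega⟩
      refine key {k + 1} (by simp only [Finset.mem_singleton]; omega)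
        (fun j => by have := j.2; simp only [Finset.mem_singleton]; omega) ?_
      rw [Finset.sum_singleton, cl _ (by omega), cr _ (by omega)]
      push_cast
      linarith

/-- This is the null root: 1 on the four leaves, 2 elsewhere. The bound 1 ≤ c, rather than mere
positivity, is what the strictness argument needs later. -/
theorem exists_weight_diagramExtD {n : ℕ} (hn : 4 ≤ n) : ∃ c : Fin (n + 1) → ℝ, (∀ i, 1 ≤ c i) ∧
    ∀ i, neighborSum (diagramExtD n) c i = 2 * c i := by
  let c : ℕ → ℝ := fun j => if 1 ≤ j ∧ j + 3 ≤ n then 2 else 1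
  refine ⟨fun i => c i, fun i => ?_, fun i => ?_⟩
  · simp only [c]
    split_ifs <;> norm_num
  · obtain ⟨i, hi⟩ := i
    have key : ∀ S : Finset ℕ, (∀ j ∈ S, j < n + 1) →
        (∀ j : Fin (n + 1), (i ≠ j ∧ (((i + 1 = j ∧ (j : ℕ) + 1 < n) ∨ (i = 1 ∧ (j : ℕ) + 1 = n) ∨
          (i + 3 = n ∧ (j : ℕ) = n)) ∨ (((j : ℕ) + 1 = i ∧ i + 1 < n) ∨
            ((j : ℕ) = 1 ∧ i + 1 = n) ∨ ((j : ℕ) + 3 = n ∧ i = n)))) ↔ (j : ℕ) ∈ S) →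
        ∑ j ∈ S, c j = 2 * c i →
        neighborSum (diagramExtD n) (fun i => c i) ⟨i, hi⟩ = 2 * c i := by
      intro S h1 h2 h3
      rwa [neighborSum_fin _ c _ S h1 fun j => by
        rw [diagramExtD, SimpleGraph.fromRel_adj, ← h2, ne_eq, Fin.ext_iff]]
    have c1 : ∀ j, ¬ (1 ≤ j ∧ j + 3 ≤ n) → c j = 1 := fun j hj => if_neg hj
    have c2 : ∀ j, 1 ≤ j ∧ j + 3 ≤ n → c j = 2 := fun j hj => if_pos hj
    clear_value c
    obtain rfl | rfl | h | h | h | h | h :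
        i = 0 ∨ i = 1 ∨ (2 ≤ i ∧ i + 3 < n) ∨ (2 ≤ i ∧ i + 3 = n) ∨ i = n - 2 ∨ i = n - 1 ∨
          i = n := by omega
    · refine key {1} (by simp only [Finset.mem_singleton]; omega)
        (fun j => by have := j.2; simp only [Finset.mem_singleton]; omega) ?_
      rw [Finset.sum_singleton, c1 0 (by omega), c2 1 (by omega)]
      norm_num
    -- For n = 4 the branch vertices 1 and n−3 coincide and the centre has four neighbours.
    · rcases hn.eq_or_lt with rfl | hn
      · refine key {0, 2, 3, 4} (by simp only [Finset.mem_insert, Finset.mem_singleton]; omega)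
          (fun j => by have := j.2; simp only [Finset.mem_insert, Finset.mem_singleton, true_and]; omega) ?_
        rw [Finset.sum_insert (by simp only [Finset.mem_insert, Finset.mem_singleton]; omega), Finset.sum_insert (by simp only [Finset.mem_insert, Finset.mem_singleton]; omega), Finset.sum_pair (by omega),
          c1 0 (by omega), c2 1 (by omega), c1 2 (by omega), c1 3 (by omega), c1 4 (by omega)]
        norm_num
      · refine key {0, 2, n - 1} (by simp only [Finset.mem_insert, Finset.mem_singleton]; omega)
          (fun j => by have := j.2; simp only [Finset.mem_insert, Finset.mem_singleton, true_and]; omega) ?_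
        rw [Finset.sum_insert (by simp only [Finset.mem_insert, Finset.mem_singleton]; omega), Finset.sum_pair (by omega),
          c1 0 (by omega), c2 1 (by omega), c2 2 (by omega), c1 (n - 1) (by omega)]
        norm_num
    · refine key {i - 1, i + 1} (by simp only [Finset.mem_insert, Finset.mem_singleton]; omega)
        (fun j => by have := j.2; simp only [Finset.mem_insert, Finset.mem_singleton]; omega) ?_
      rw [Finset.sum_pair (by omega), c2 (i - 1) (by omega), c2 i (by omega),
        c2 (i + 1) (by omega)]
      norm_num
    · refine key {i - 1, i + 1, n} (by simp only [Finset.mem_insert, Finset.mem_singleton]; omega)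
        (fun j => by have := j.2; simp only [Finset.mem_insert, Finset.mem_singleton]; omega) ?_
      rw [Finset.sum_insert (by simp only [Finset.mem_insert, Finset.mem_singleton]; omega), Finset.sum_pair (by omega),
        c2 (i - 1) (by omega), c2 i (by omega), c1 (i + 1) (by omega), c1 n (by omega)]
      norm_num
    · refine key {n - 3} (by simp only [Finset.mem_singleton]; omega)
        (fun j => by have := j.2; simp only [Finset.mem_singleton]; omega) ?_
      rw [Finset.sum_singleton, c2 (n - 3) (by omega), c1 i (by omega)]
      norm_num
    · refine key {1} (by simp only [Finset.mem_singleton]; omega)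
        (fun j => by have := j.2; simp only [Finset.mem_singleton]; omega) ?_
      rw [Finset.sum_singleton, c2 1 (by omega), c1 i (by omega)]
      norm_num
    · refine key {n - 3} (by simp only [Finset.mem_singleton]; omega)
        (fun j => by have := j.2; simp only [Finset.mem_singleton]; omega) ?_
      rw [Finset.sum_singleton, c2 (n - 3) (by omega), c1 i (by omega)]
      norm_num

theorem exists_weight_of_nat_lt {n : ℕ} (G : SimpleGraph (Fin n)) [DecidableRel G.Adj]
    (c : Fin n → ℕ) (hc : ∀ i, 0 < c i)
    (h : ∀ i, (∑ j, if G.Adj i j then c j else 0) < 2 * c i) :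
    ∃ c : Fin n → ℝ, (∀ i, 0 < c i) ∧ ∀ i, neighborSum G c i < 2 * c i := by
  refine ⟨fun i => c i, fun i => Nat.cast_pos.2 (hc i), fun i => ?_⟩
  rw [neighborSum_natCast]
  beta_reduce
  exact_mod_cast h i

theorem exists_weight_of_nat_eq {n : ℕ} (G : SimpleGraph (Fin n)) [DecidableRel G.Adj]
    (c : Fin n → ℕ) (hc : ∀ i, 1 ≤ c i)
    (h : ∀ i, (∑ j, if G.Adj i j then c j else 0) = 2 * c i) :
    ∃ c : Fin n → ℝ, (∀ i, 1 ≤ c i) ∧ ∀ i, neighborSum G c i = 2 * c i := by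
  refine ⟨fun i => c i, fun i => Nat.one_le_cast.2 (hc i), fun i => ?_⟩
  rw [neighborSum_natCast]
  beta_reduce
  exact_mod_cast h i

instance (n : ℕ) : DecidableRel (diagramE n).Adj := by
  unfold diagramE
  infer_instance

instance : DecidableRel diagramExtE6.Adj := by
  unfold diagramExtE6
  infer_instance

instance : DecidableRel diagramExtE7.Adj := by
  unfold diagramExtE7
  infer_instance

/-- As for A_n, the entries solve 2c − Ac = 2; the same holds for E_7 and E_8 below. -/
theorem exists_weight_diagramE6 : ∃ c : Fin 6 → ℝ, (∀ i, 0 < c i) ∧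
    ∀ i, neighborSum (diagramE 6) c i < 2 * c i :=
  exists_weight_of_nat_lt _ ![16, 30, 42, 30, 16, 22] (by decide) (by decide)

theorem exists_weight_diagramE7 : ∃ c : Fin 7 → ℝ, (∀ i, 0 < c i) ∧
    ∀ i, neighborSum (diagramE 7) c i < 2 * c i :=
  exists_weight_of_nat_lt _ ![34, 66, 96, 75, 52, 27, 49] (by decide) (by decide)

theorem exists_weight_diagramE8 : ∃ c : Fin 8 → ℝ, (∀ i, 0 < c i) ∧
    ∀ i, neighborSum (diagramE 8) c i < 2 * c i :=
  exists_weight_of_nat_lt _ ![92, 182, 270, 220, 168, 114, 58, 136] (by decide) (by decide)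

theorem exists_weight_diagramE9 : ∃ c : Fin 9 → ℝ, (∀ i, 1 ≤ c i) ∧
    ∀ i, neighborSum (diagramE 9) c i = 2 * c i :=
  exists_weight_of_nat_eq _ ![2, 4, 6, 5, 4, 3, 2, 1, 3] (by decide) (by decide)

theorem exists_weight_diagramExtE6 : ∃ c : Fin 7 → ℝ, (∀ i, 1 ≤ c i) ∧
    ∀ i, neighborSum diagramExtE6 c i = 2 * c i :=
  exists_weight_of_nat_eq _ ![1, 2, 3, 2, 1, 2, 1] (by decide) (by decide)

theorem exists_weight_diagramExtE7 : ∃ c : Fin 8 → ℝ, (∀ i, 1 ≤ c i) ∧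
    ∀ i, neighborSum diagramExtE7 c i = 2 * c i :=
  exists_weight_of_nat_eq _ ![1, 2, 3, 4, 3, 2, 1, 2] (by decide) (by decide)

end Diagrams

/-! ### Graphs on `Fin n` described by relations on natural numbers -/

section NatLabels

/-- The adjacency of `G` is given by the relation `R` on the natural numbers labelling the
vertices. -/
def IsLabelled {n : ℕ} (G : SimpleGraph (Fin n)) (R : ℕ → ℕ → Prop) : Prop :=
  ∀ a b : Fin n, G.Adj a b ↔ R a b

variable {m n : ℕ} {G : SimpleGraph (Fin m)} {G' : SimpleGraph (Fin n)} {R R' : ℕ → ℕ → Prop}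

/-- Reduces an embedding of diagrams to arithmetic on labels, within reach of `omega`. -/
theorem IsLabelled.isContained (hG : IsLabelled G R) (hG' : IsLabelled G' R') (f : ℕ → ℕ)
    (hf : ∀ a, a < m → f a < n) (hinj : ∀ a b, a < m → b < m → f a = f b → a = b)
    (hR : ∀ a b, a < m → b < m → R a b → R' (f a) (f b)) : G ⊑ G' :=
  ⟨⟨⟨fun a => ⟨f a, hf a a.2⟩, fun {a b} h =>
      (hG' _ _).2 (hR a b a.2 b.2 ((hG a b).1 h))⟩,
    fun a b h => Fin.ext (hinj a b a.2 b.2 (Fin.ext_iff.1 h))⟩⟩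

theorem IsLabelled.nonempty_iso {G : SimpleGraph (Fin n)} (hG' : IsLabelled G' R')
    (hG : IsLabelled G R) (f : ℕ → ℕ)
    (hf : ∀ a, a < n → f a < n) (hinj : ∀ a b, a < n → b < n → f a = f b → a = b)
    (hR : ∀ a b, a < n → b < n → (R' (f a) (f b) ↔ R a b)) : Nonempty (G' ≃g G) := by
  let F : Fin n → Fin n := fun a => ⟨f a, hf a a.2⟩
  have hF : Function.Injective F :=
    fun a b h => Fin.ext (hinj a b a.2 b.2 (Fin.ext_iff.1 h))
  refine ⟨SimpleGraph.Iso.symm ⟨Equiv.ofBijective F (Finite.injective_iff_bijective.1 hF), ?_⟩⟩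
  intro a b
  change G'.Adj (F a) (F b) ↔ G.Adj a b
  rw [hG', hG]
  exact hR a b a.2 b.2

/-- The graph obtained from `G` by attaching the new leaf `n` to the vertex `k`. -/
def addLeaf (G : SimpleGraph (Fin n)) (k : Fin n) : SimpleGraph (Fin (n + 1)) where
  Adj a b := (∃ x y, G.Adj x y ∧ x.castSucc = a ∧ y.castSucc = b) ∨
    (a = Fin.last n ∧ b = k.castSucc) ∨ (a = k.castSucc ∧ b = Fin.last n)
  symm := ⟨by
    rintro a b (⟨x, y, h, rfl, rfl⟩ | ⟨rfl, rfl⟩ | ⟨rfl, rfl⟩)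
    · exact Or.inl ⟨y, x, h.symm, rfl, rfl⟩
    · exact Or.inr (Or.inr ⟨rfl, rfl⟩)
    · exact Or.inr (Or.inl ⟨rfl, rfl⟩)⟩
  loopless := ⟨by
    rintro a (⟨x, y, h, rfl, h'⟩ | ⟨rfl, h⟩ | ⟨h, rfl⟩)
    · exact h.ne (Fin.castSucc_injective n h').symm
    · exact (Fin.castSucc_lt_last k).ne h.symm
    · exact (Fin.castSucc_lt_last k).ne h.symm⟩

/-- The labelling relation of `addLeaf`. -/
def leafRel (R : ℕ → ℕ → Prop) (n k a b : ℕ) : Prop :=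
  (a < n ∧ b < n ∧ R a b) ∨ (a = n ∧ b = k) ∨ (a = k ∧ b = n)

theorem IsLabelled.addLeaf (hG : IsLabelled G' R) (k : Fin n) :
    IsLabelled (addLeaf G' k) (leafRel R n k) := by
  intro a b
  simp only [SubspaceConfig.addLeaf, leafRel, Fin.ext_iff, Fin.val_last, Fin.val_castSucc]
  refine or_congr ⟨?_, ?_⟩ Iff.rfl
  · rintro ⟨x, y, h, hx, hy⟩
    rw [← hx, ← hy]
    exact ⟨x.2, y.2, (hG x y).1 h⟩
  · rintro ⟨ha, hb, h⟩
    exact ⟨⟨a, ha⟩, ⟨b, hb⟩, (hG _ _).2 h, rfl, rfl⟩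

/-- The labelling relation of a path. -/
def pathRel (a b : ℕ) : Prop := a + 1 = b ∨ b + 1 = a

/-- The labelling relation of `diagramD`. -/
def relD (n a b : ℕ) : Prop :=
  (a + 1 = b ∧ b + 1 < n) ∨ (a + 3 = n ∧ b + 1 = n) ∨
    (b + 1 = a ∧ a + 1 < n) ∨ (b + 3 = n ∧ a + 1 = n)

/-- The labelling relation of `diagramE`. -/
def relE (n a b : ℕ) : Prop :=
  (a + 1 = b ∧ b + 1 < n) ∨ (a = 2 ∧ b + 1 = n) ∨
    (b + 1 = a ∧ a + 1 < n) ∨ (b = 2 ∧ a + 1 = n)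

/-- The labelling relation of `diagramExtD`. -/
def relExtD (n a b : ℕ) : Prop :=
  (a + 1 = b ∧ b + 1 < n) ∨ (a = 1 ∧ b + 1 = n) ∨ (a + 3 = n ∧ b = n) ∨
    (b + 1 = a ∧ a + 1 < n) ∨ (b = 1 ∧ a + 1 = n) ∨ (b + 3 = n ∧ a = n)

/-- The labelling relation of `diagramExtE6`. -/
def relExtE6 (a b : ℕ) : Prop :=
  (a + 1 = b ∧ b ≤ 4) ∨ (a = 2 ∧ b = 5) ∨ (a = 5 ∧ b = 6) ∨
    (b + 1 = a ∧ a ≤ 4) ∨ (b = 2 ∧ a = 5) ∨ (b = 5 ∧ a = 6)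

/-- The labelling relation of `diagramExtE7`. -/
def relExtE7 (a b : ℕ) : Prop :=
  (a + 1 = b ∧ b ≤ 6) ∨ (a = 3 ∧ b = 7) ∨ (b + 1 = a ∧ a ≤ 6) ∨ (b = 3 ∧ a = 7)

theorem isLabelled_pathGraph (n : ℕ) : IsLabelled (SimpleGraph.pathGraph n) pathRel :=
  fun _ _ => SimpleGraph.pathGraph_adj

theorem isLabelled_diagramD (n : ℕ) : IsLabelled (diagramD n) (relD n) := by
  intro a b
  rw [diagramD, SimpleGraph.fromRel_adj, relD, ne_eq, Fin.ext_iff]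
  omega

/-- Some lower bound on n is needed: at n = 3 `relE` relates 2 to itself, a loop that `fromRel`
discards. -/
theorem isLabelled_diagramE {n : ℕ} (hn : 4 ≤ n) : IsLabelled (diagramE n) (relE n) := by
  intro a b
  rw [diagramE, SimpleGraph.fromRel_adj, relE, ne_eq, Fin.ext_iff]
  omega

theorem isLabelled_diagramExtD {n : ℕ} (hn : 4 ≤ n) :
    IsLabelled (diagramExtD n) (relExtD n) := by
  intro a b
  rw [diagramExtD, SimpleGraph.fromRel_adj, relExtD, ne_eq, Fin.ext_iff]
  omega

theorem isLabelled_diagramExtE6 : IsLabelled diagramExtE6 relExtE6 := by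
  intro a b
  rw [diagramExtE6, SimpleGraph.fromRel_adj, relExtE6, ne_eq, Fin.ext_iff]
  omega

theorem isLabelled_diagramExtE7 : IsLabelled diagramExtE7 relExtE7 := by
  intro a b
  rw [diagramExtE7, SimpleGraph.fromRel_adj, relExtE7, ne_eq, Fin.ext_iff]
  omega

end NatLabels

/-! ### Adding one leaf to a Dynkin diagram -/

section Containment

/-- `Γ` contains a copy of an extended Dynkin diagram. -/
def ContainsExtended {V : Type*} (Γ : SimpleGraph V) : Prop :=
  (∃ n : ℕ, 4 ≤ n ∧ diagramExtD n ⊑ Γ) ∨ diagramExtE6 ⊑ Γ ∨ diagramExtE7 ⊑ Γ ∨ diagramE 9 ⊑ Γ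

theorem ContainsExtended.mono {V W : Type*} {Γ : SimpleGraph V} {G : SimpleGraph W}
    (h : ContainsExtended Γ) (hc : Γ ⊑ G) : ContainsExtended G := by
  rcases h with ⟨n, hn, h⟩ | h | h | h
  · exact Or.inl ⟨n, hn, h.trans hc⟩
  · exact Or.inr (Or.inl (h.trans hc))
  · exact Or.inr (Or.inr (Or.inl (h.trans hc)))
  · exact Or.inr (Or.inr (Or.inr (h.trans hc)))

theorem IsDynkin.of_iso {V : Type*} {W : Type*} {Γ : SimpleGraph V} {G : SimpleGraph W}
    (h : IsDynkin G) (e : Γ ≃g G) : IsDynkin Γ := by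
  rcases h with ⟨n, hn, ⟨f⟩⟩ | ⟨n, hn, ⟨f⟩⟩ | ⟨⟨f⟩⟩ | ⟨⟨f⟩⟩ | ⟨⟨f⟩⟩
  · exact Or.inl ⟨n, hn, ⟨e.trans f⟩⟩
  · exact Or.inr (Or.inl ⟨n, hn, ⟨e.trans f⟩⟩)
  · exact Or.inr (Or.inr (Or.inl ⟨e.trans f⟩))
  · exact Or.inr (Or.inr (Or.inr (Or.inl ⟨e.trans f⟩)))
  · exact Or.inr (Or.inr (Or.inr (Or.inr ⟨e.trans f⟩)))

theorem isDynkin_or_containsExtended_of_iso {V W : Type*} {Γ : SimpleGraph V}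
    {G : SimpleGraph W} (h : IsDynkin G ∨ ContainsExtended G) (e : Γ ≃g G) :
    IsDynkin Γ ∨ ContainsExtended Γ :=
  h.imp (fun h => h.of_iso e) fun h => h.mono ⟨e.symm.toCopy⟩

/-- A graph with `n ≥ 5` vertices that is isomorphic to `diagramE n`, or contains a copy of
`diagramE 9`, is Dynkin or contains an extended Dynkin diagram. -/
theorem isDynkin_or_containsExtended_of_diagramE {n : ℕ} (hn : 5 ≤ n) {G : SimpleGraph (Fin n)}
    (h : n ≤ 8 → Nonempty (G ≃g diagramE n)) (h9 : 9 ≤ n → diagramE 9 ⊑ G) :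
    IsDynkin G ∨ ContainsExtended G := by
  by_cases h8 : n ≤ 8
  · have h := h h8
    left
    interval_cases n
    -- The diagram "E_5" is D_5, with the same labels.
    · obtain ⟨e⟩ := h
      have : Nonempty (diagramE 5 ≃g diagramD 5) :=
        (isLabelled_diagramE (by norm_num)).nonempty_iso (isLabelled_diagramD _) id
          (fun a h => h) (fun a b _ _ h => h) (fun a b ha hb => by
            simp only [relE, relD, id]; omega)
      exact Or.inr (Or.inl ⟨5, by norm_num, ⟨e.trans this.some⟩⟩)
    · exact Or.inr (Or.inr (Or.inl h))
    · exact Or.inr (Or.inr (Or.inr (Or.inl h)))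
    · exact Or.inr (Or.inr (Or.inr (Or.inr h)))
  · exact Or.inr (Or.inr (Or.inr (Or.inr (h9 (by omega)))))

/-- The version of `isDynkin_or_containsExtended_of_diagramE` with a single labelling map. -/
theorem IsLabelled.isDynkin_or_containsExtended {n : ℕ} (hn : 5 ≤ n) {G : SimpleGraph (Fin n)}
    {R : ℕ → ℕ → Prop} (hG : IsLabelled G R) (f : ℕ → ℕ) (hf : ∀ a, a < n → f a < n)
    (hinj : ∀ a b, a < n → b < n → f a = f b → a = b)
    (hR : ∀ a b, a < n → b < n → (R (f a) (f b) ↔ relE n a b)) :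
    IsDynkin G ∨ ContainsExtended G := by
  have e : Nonempty (G ≃g diagramE n) :=
    hG.nonempty_iso (isLabelled_diagramE (by omega)) f hf hinj hR
  refine isDynkin_or_containsExtended_of_diagramE hn (fun _ => e) fun h9 => ?_
  refine SimpleGraph.IsContained.trans ?_ ⟨e.some.symm.toCopy⟩
  -- Truncate the long arm at vertex 7 and send the short leaf 8 to the short leaf n−1.
  refine (isLabelled_diagramE (by norm_num)).isContained (isLabelled_diagramE (by omega))
    (fun a => if a = 8 then n - 1 else a) (fun a ha => ?_) (fun a b ha hb h => ?_)
    (fun a b ha hb h => ?_)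
  · split_ifs <;> omega
  · split_ifs at h <;> omega
  · simp only [relE] at h ⊢; split_ifs <;> omega

/-- The distance from k to the nearer end decides: 0 gives A, 1 gives D, 2 gives the E series, and
at least 3 leaves room for Ẽ_7 centred at k. -/
theorem addLeaf_pathGraph {n : ℕ} (k : Fin n) :
    IsDynkin (addLeaf (SimpleGraph.pathGraph n) k) ∨
      ContainsExtended (addLeaf (SimpleGraph.pathGraph n) k) := by
  have hL := (isLabelled_pathGraph n).addLeaf k
  obtain ⟨k, hk⟩ := k
  dsimp only at hL
  by_cases h1 : k + 1 = n
  · refine Or.inl (Or.inl ⟨n + 1, by omega, hL.nonempty_iso (isLabelled_pathGraph _) id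
      (fun a h => h) (fun a b _ _ h => h) fun a b ha hb => ?_⟩)
    simp only [leafRel, pathRel, id]; omega
  by_cases h2 : k = 0
  · refine Or.inl (Or.inl ⟨n + 1, by omega, hL.nonempty_iso (isLabelled_pathGraph _)
      (fun a => if a = 0 then n else a - 1) (fun a ha => ?_) (fun a b ha hb h => ?_)
      fun a b ha hb => ?_⟩)
    · split_ifs <;> omega
    · split_ifs at h <;> omega
    · simp only [leafRel, pathRel]; split_ifs <;> omega
  by_cases h3 : k + 2 = n
  · refine Or.inl (Or.inr (Or.inl ⟨n + 1, by omega, hL.nonempty_iso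
      (isLabelled_diagramD _) id (fun a h => h) (fun a b _ _ h => h)
      fun a b ha hb => ?_⟩))
    simp only [leafRel, pathRel, relD, id]; omega
  by_cases h4 : k = 1
  · refine Or.inl (Or.inr (Or.inl ⟨n + 1, by omega, hL.nonempty_iso
      (isLabelled_diagramD _) (fun a => if a = n then n else n - 1 - a)
      (fun a ha => ?_) (fun a b ha hb h => ?_) fun a b ha hb => ?_⟩))
    · split_ifs <;> omega
    · split_ifs at h <;> omega
    · simp only [leafRel, pathRel, relD]; split_ifs <;> omega
  by_cases h5 : k = 2
  · refine hL.isDynkin_or_containsExtended (by omega) id (fun a h => h) (fun a b _ _ h => h)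
      fun a b ha hb => ?_
    simp only [leafRel, pathRel, relE, id]; omega
  by_cases h6 : k + 3 = n
  · refine hL.isDynkin_or_containsExtended (by omega) (fun a => if a = n then n else n - 1 - a)
      (fun a ha => ?_) (fun a b ha hb h => ?_) fun a b ha hb => ?_
    · split_ifs <;> omega
    · split_ifs at h <;> omega
    · simp only [leafRel, pathRel, relE]; split_ifs <;> omega
  · refine Or.inr (Or.inr (Or.inr (Or.inl (isLabelled_diagramExtE7.isContained hL
      (fun a => if a = 7 then n else k - 3 + a) (fun a ha => ?_) (fun a b ha hb h => ?_)
      fun a b ha hb h => ?_))))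
    · split_ifs <;> omega
    · split_ifs at h <;> omega
    · simp only [leafRel, pathRel, relExtE7] at h ⊢
      rcases h with h | h | h | h <;> split_ifs <;> omega

set_option maxHeartbeats 1000000 in
theorem addLeaf_diagramD {n : ℕ} (hn : 4 ≤ n) (k : Fin n) :
    IsDynkin (addLeaf (diagramD n) k) ∨ ContainsExtended (addLeaf (diagramD n) k) := by
  have hL := (isLabelled_diagramD n).addLeaf k
  obtain ⟨k, hk⟩ := k
  dsimp only at hL
  by_cases h1 : k = 0
  · refine Or.inl (Or.inr (Or.inl ⟨n + 1, by omega, hL.nonempty_iso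
      (isLabelled_diagramD _) (fun a => if a = 0 then n else a - 1)
      (fun a ha => ?_) (fun a b ha hb h => ?_) fun a b ha hb => ?_⟩))
    · split_ifs <;> omega
    · split_ifs at h <;> omega
    · simp only [leafRel, relD]; split_ifs <;> omega
  by_cases h2 : k + 3 ≤ n
  -- The new branching at k and the old one at n−3 bound a copy of D̃; they coincide when k = n−3.
  · refine Or.inr (Or.inl ⟨n - k + 1, by omega, (isLabelled_diagramExtD (by omega)).isContained hL
      (fun a => if a = n - k then n else if a = n - k + 1 then n - 1 else k - 1 + a)
      (fun a ha => ?_) (fun a b ha hb h => ?_) fun a b ha hb h => ?_⟩)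
    · split_ifs <;> omega
    · split_ifs at h <;> omega
    · simp only [leafRel, relD, relExtD] at h ⊢; grind
  -- Here k is a fork leaf, which becomes an arm of length 2; 2n−3−k is the other fork leaf.
  · refine hL.isDynkin_or_containsExtended (by omega)
      (fun a => if a = 0 then n else if a = 1 then k else if a = n then 2 * n - 3 - k
        else n - 1 - a)
      (fun a ha => ?_) (fun a b ha hb h => ?_) fun a b ha hb => ?_
    · split_ifs <;> omega
    · split_ifs at h <;> omega
    · simp only [leafRel, relD, relE]; split_ifs <;> omega

set_option maxHeartbeats 1000000 in
theorem addLeaf_diagramE {n : ℕ} (hn : 6 ≤ n) (k : Fin n) :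
    IsDynkin (addLeaf (diagramE n) k) ∨ ContainsExtended (addLeaf (diagramE n) k) := by
  have hL := (isLabelled_diagramE (by omega)).addLeaf k
  obtain ⟨k, hk⟩ := k
  dsimp only at hL
  by_cases h1 : k + 2 = n
  · refine hL.isDynkin_or_containsExtended (by omega)
      (fun a => if a = n then n - 1 else if a = n - 1 then n else a)
      (fun a ha => ?_) (fun a b ha hb h => ?_) fun a b ha hb => ?_
    · split_ifs <;> omega
    · split_ifs at h <;> omega
    · simp only [leafRel, relE]; split_ifs <;> omega
  by_cases h2 : k = 1
  · refine Or.inr (Or.inl ⟨5, by omega, (isLabelled_diagramExtD (by omega)).isContained hL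
      (fun a => if a = 4 then n else if a = 5 then n - 1 else a)
      (fun a ha => ?_) (fun a b ha hb h => ?_) fun a b ha hb h => ?_⟩)
    · split_ifs <;> omega
    · split_ifs at h <;> omega
    · simp only [leafRel, relE, relExtD] at h ⊢; grind
  by_cases h3 : k = 0
  -- On E_6 the two long arms are interchangeable, so the result is E_7; for n ≥ 7 both arms reach
  -- length 3 and Ẽ_7 appears.
  · by_cases h6 : n = 6
    · subst h6
      refine hL.isDynkin_or_containsExtended (by omega)
        (fun a => if a = 6 then 5 else if a = 5 then 6 else 4 - a)
        (fun a ha => ?_) (fun a b ha hb h => ?_) fun a b ha hb => ?_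
      · split_ifs <;> omega
      · split_ifs at h <;> omega
      · simp only [leafRel, relE]; split_ifs <;> omega
    · refine Or.inr (Or.inr (Or.inr (Or.inl (isLabelled_diagramExtE7.isContained hL
        (fun a => if a = 7 then n - 1 else if a = 0 then n else a - 1)
        (fun a ha => ?_) (fun a b ha hb h => ?_) fun a b ha hb h => ?_))))
      · split_ifs <;> omega
      · split_ifs at h <;> omega
      · simp only [leafRel, relE, relExtE7] at h ⊢
        rcases h with h | h | h | h <;> split_ifs <;> omega
  by_cases h4 : k + 1 = n
  · refine Or.inr (Or.inr (Or.inl (isLabelled_diagramExtE6.isContained hL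
      (fun a => if a = 5 then n - 1 else if a = 6 then n else a)
      (fun a ha => ?_) (fun a b ha hb h => ?_) fun a b ha hb h => ?_)))
    · split_ifs <;> omega
    · split_ifs at h <;> omega
    · simp only [leafRel, relE, relExtE6] at h ⊢
      rcases h with h | h | h | h | h | h <;> split_ifs <;> omega
  -- Now 2 ≤ k ≤ n−3, and D̃ stretches between the branch vertices 2 and k.
  · refine Or.inr (Or.inl ⟨k + 2, by omega, (isLabelled_diagramExtD (by omega)).isContained hL
      (fun a => if a = k + 1 then n - 1 else if a = k + 2 then n else a + 1)
      (fun a ha => ?_) (fun a b ha hb h => ?_) fun a b ha hb h => ?_⟩)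
    · split_ifs <;> omega
    · split_ifs at h <;> omega
    · simp only [leafRel, relE, relExtD] at h ⊢; grind

end Containment

/-! ### Every finite tree is Dynkin or contains an extended diagram -/

section Classification

variable {V : Type*} {Γ : SimpleGraph V}

open scoped Classical in
theorem nonempty_iso_addLeaf {n : ℕ} {G : SimpleGraph (Fin n)} {v u : V} (hvu : Γ.Adj v u)
    (hu : ∀ w, Γ.Adj v w → w = u) (e : Γ.induce {v}ᶜ ≃g G) :
    Nonempty (Γ ≃g addLeaf G (e ⟨u, hvu.ne'⟩)) := by
  let F : V → Fin (n + 1) := fun a => if h : a = v then Fin.last n else (e ⟨a, h⟩).castSucc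
  have Fv : F v = Fin.last n := dif_pos rfl
  have Fn : ∀ a (h : a ≠ v), F a = (e ⟨a, h⟩).castSucc := fun a h => dif_neg h
  have hinj : Function.Injective F := by
    intro a b h
    by_cases ha : a = v <;> by_cases hb : b = v
    · rw [ha, hb]
    · rw [ha, Fv, Fn b hb] at h
      exact absurd h.symm (Fin.castSucc_lt_last _).ne
    · rw [hb, Fv, Fn a ha] at h
      exact absurd h (Fin.castSucc_lt_last _).ne
    · rw [Fn a ha, Fn b hb] at h
      exact congrArg Subtype.val (e.injective (Fin.castSucc_injective n h))
  have hsurj : Function.Surjective F := by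
    intro j
    induction j using Fin.lastCases with
    | last => exact ⟨v, Fv⟩
    | cast j =>
      obtain ⟨⟨a, ha⟩, rfl⟩ := e.surjective j
      exact ⟨a, Fn a ha⟩
  refine ⟨⟨Equiv.ofBijective F ⟨hinj, hsurj⟩, ?_⟩⟩
  intro a b
  change (addLeaf G _).Adj (F a) (F b) ↔ Γ.Adj a b
  have hFu : F u = (e ⟨u, hvu.ne'⟩).castSucc := Fn u hvu.ne'
  constructor
  · rintro (⟨x, y, h, hx, hy⟩ | ⟨ha, hb⟩ | ⟨ha, hb⟩)
    · obtain ⟨⟨a', ha'⟩, rfl⟩ := e.surjective x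
      obtain ⟨⟨b', hb'⟩, rfl⟩ := e.surjective y
      rw [← Fn a' ha'] at hx
      rw [← Fn b' hb'] at hy
      obtain rfl := hinj hx
      obtain rfl := hinj hy
      exact e.map_adj_iff.1 h
    · rw [← Fv] at ha
      rw [← hFu] at hb
      rwa [hinj ha, hinj hb]
    · rw [← Fv] at hb
      rw [← hFu] at ha
      rw [hinj ha, hinj hb]
      exact hvu.symm
  · intro h
    by_cases ha : a = v
    · subst ha
      obtain rfl := hu b h
      exact Or.inr (Or.inl ⟨Fv, hFu⟩)
    by_cases hb : b = v
    · subst hb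
      obtain rfl := hu a h.symm
      exact Or.inr (Or.inr ⟨hFu, Fv⟩)
    · exact Or.inl ⟨_, _, e.map_adj_iff.2 (show (Γ.induce {v}ᶜ).Adj ⟨a, ha⟩ ⟨b, hb⟩ from h),
        (Fn a ha).symm, (Fn b hb).symm⟩

theorem isDynkin_of_card_eq_one [Finite V] (h : Nat.card V = 1) : IsDynkin Γ := by
  have e : V ≃ Fin 1 := Finite.equivFinOfCardEq h
  refine Or.inl ⟨1, le_rfl, ⟨⟨e, fun {a b} => ?_⟩⟩⟩
  have : Subsingleton V := e.subsingleton
  rw [Subsingleton.elim a b]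
  simp

/-- Delete a leaf and induct: an extended diagram in the smaller tree persists, and a Dynkin diagram
is handled by the one-leaf case analysis. -/
theorem isDynkin_or_containsExtended (n : ℕ) : ∀ {V : Type u} [Finite V] {Γ : SimpleGraph V},
    Γ.IsTree → Nat.card V = n + 1 → IsDynkin Γ ∨ ContainsExtended Γ := by
  induction n with
  | zero => exact fun _ h => Or.inl (isDynkin_of_card_eq_one h)
  | succ n ih =>
    intro V _ Γ hΓ hcard
    classical
    have := Fintype.ofFinite V
    have hnt : Nontrivial V := by
      rw [← Finite.one_lt_card_iff_nontrivial]
      omega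
    obtain ⟨v, hv⟩ := hΓ.exists_vert_degree_one_of_nontrivial
    obtain ⟨u, hvu, hu⟩ := SimpleGraph.degree_eq_one_iff_existsUnique_adj.1 hv
    have hT : (Γ.induce {v}ᶜ).IsTree :=
      ⟨hΓ.connected.induce_compl_singleton_of_degree_eq_one hv, hΓ.isAcyclic.induce _⟩
    have hc : Nat.card ({v}ᶜ : Set V) = n + 1 := by
      have h1 := Set.ncard_add_ncard_compl ({v} : Set V)
      rw [Set.ncard_singleton, hcard] at h1
      change ({v}ᶜ : Set V).ncard = _
      omega
    rcases ih hT hc with h | h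
    · rcases h with ⟨m, hm, ⟨e⟩⟩ | ⟨m, hm, ⟨e⟩⟩ | ⟨⟨e⟩⟩ | ⟨⟨e⟩⟩ | ⟨⟨e⟩⟩
      · exact isDynkin_or_containsExtended_of_iso (addLeaf_pathGraph _)
          (nonempty_iso_addLeaf hvu hu e).some
      · exact isDynkin_or_containsExtended_of_iso (addLeaf_diagramD hm _)
          (nonempty_iso_addLeaf hvu hu e).some
      · exact isDynkin_or_containsExtended_of_iso (addLeaf_diagramE (by norm_num) _)
          (nonempty_iso_addLeaf hvu hu e).some
      · exact isDynkin_or_containsExtended_of_iso (addLeaf_diagramE (by norm_num) _)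
          (nonempty_iso_addLeaf hvu hu e).some
      · exact isDynkin_or_containsExtended_of_iso (addLeaf_diagramE (by norm_num) _)
          (nonempty_iso_addLeaf hvu hu e).some
    · exact Or.inr (h.mono ⟨SimpleGraph.Copy.induce Γ _⟩)

end Classification

/-! ### Proper containment of an extended diagram -/

section Strictness

variable {V W : Type*} [Fintype V] [Fintype W] {Γ : SimpleGraph V} {G : SimpleGraph W}

theorem sum_sq_extend {f : W → V} (hf : Function.Injective f) (y : W → ℝ) :
    ∑ i, Function.extend f y 0 i ^ 2 = ∑ a, y a ^ 2 := by
  refine (Fintype.sum_of_injective f hf _ _ (fun i hi => ?_) fun a => ?_).symm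
  · rw [Function.extend_apply' _ _ _ hi]
    simp
  · rw [hf.extend_apply]

theorem adjForm_extend {f : W → V} (hf : Function.Injective f) (y : W → ℝ) :
    adjForm Γ (Function.extend f y 0) = adjForm (Γ.comap f) y := by
  classical
  refine (Fintype.sum_of_injective f hf _ _ (fun i hi => ?_) fun a => ?_).symm
  · rw [Function.extend_apply' _ _ _ hi]
    simp
  · refine Fintype.sum_of_injective f hf _ _ (fun i hi => ?_) fun b => ?_
    · rw [Function.extend_apply' _ _ i hi]
      simp
    · rw [hf.extend_apply, hf.extend_apply]
      rfl

theorem adjForm_mono {G' : SimpleGraph W} (h : G ≤ G') {y : W → ℝ} (hy : ∀ i, 0 ≤ y i) :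
    adjForm G y ≤ adjForm G' y := by
  classical
  refine Finset.sum_le_sum fun i _ => Finset.sum_le_sum fun j _ => ?_
  have h0 := mul_nonneg (hy i) (hy j)
  by_cases hG : G.Adj i j
  · rw [if_pos hG, if_pos (h hG)]
  · rw [if_neg hG]
    split_ifs
    · exact h0
    · exact le_rfl

theorem adjForm_strictMono {G' : SimpleGraph W} (h : G < G') {y : W → ℝ} (hy : ∀ i, 0 < y i) :
    adjForm G y < adjForm G' y := by
  classical
  have hle : ∀ i j, (if G.Adj i j then y i * y j else 0) ≤ if G'.Adj i j then y i * y j else 0 := by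
    intro i j
    have h0 := mul_pos (hy i) (hy j)
    by_cases hG : G.Adj i j
    · rw [if_pos hG, if_pos (h.le hG)]
    · rw [if_neg hG]
      split_ifs
      · exact h0.le
      · exact le_rfl
  obtain ⟨a, b, hab, hab'⟩ : ∃ a b, G'.Adj a b ∧ ¬ G.Adj a b := by
    by_contra! hc
    exact h.not_ge fun a b hab => hc a b hab
  refine Finset.sum_lt_sum (fun i _ => Finset.sum_le_sum fun j _ => hle i j)
    ⟨a, Finset.mem_univ a, Finset.sum_lt_sum (fun j _ => hle a j) ⟨b, Finset.mem_univ b, ?_⟩⟩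
  rw [if_neg hab', if_pos hab]
  exact mul_pos (hy a) (hy b)

theorem adjForm_option {G' : SimpleGraph (Option W)} {a : W} (ha : G'.Adj none (some a))
    {y : Option W → ℝ} (hy : ∀ i, 0 ≤ y i) :
    adjForm (G'.comap some) (y ∘ some) + 2 * (y none * y (some a)) ≤ adjForm G' y := by
  classical
  have hnn : ∀ i j, 0 ≤ if G'.Adj i j then y i * y j else 0 := by
    intro i j
    have h0 := mul_nonneg (hy i) (hy j)
    split_ifs
    · exact h0
    · exact le_rfl
  have h1 : y none * y (some a) ≤ ∑ j, if G'.Adj none (some j) then y none * y (some j) else 0 := by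
    refine le_trans ?_ (Finset.single_le_sum (fun j _ => hnn none (some j)) (Finset.mem_univ a))
    rw [if_pos ha]
  have h2 : y none * y (some a) ≤ ∑ j, if G'.Adj (some j) none then y (some j) * y none else 0 := by
    refine le_trans ?_ (Finset.single_le_sum (fun j _ => hnn (some j) none) (Finset.mem_univ a))
    rw [if_pos ha.symm, mul_comm]
  have h3 : adjForm (G'.comap some) (y ∘ some) =
      ∑ i, ∑ j, if G'.Adj (some i) (some j) then y (some i) * y (some j) else 0 := rfl
  have h4 := hnn none none
  simp only [adjForm, Fintype.sum_option, Finset.sum_add_distrib] at h3 ⊢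
  rw [h3]
  linarith

/-- On G the null weight has Rayleigh quotient exactly 2. If Γ differs from the copy of G, it has
either an extra edge on the image or a vertex outside it, and each pushes the quotient above 2. -/
theorem nonempty_iso_or_lt_adjForm (hΓ : Γ.Connected) [Nonempty W] (hG : G ⊑ Γ) {c : W → ℝ}
    (hc : ∀ i, 1 ≤ c i) (h : ∀ i, neighborSum G c i = 2 * c i) :
    Nonempty (Γ ≃g G) ∨ ∃ x : V → ℝ, 2 * ∑ i, x i ^ 2 < adjForm Γ x := by
  classical
  obtain ⟨f⟩ := hG
  have hf : Function.Injective f := f.injective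
  have hpos : ∀ i, 0 < c i := fun i => one_pos.trans_le (hc i)
  have hle : G ≤ Γ.comap f := fun a b hab => f.toHom.map_adj hab
  have hGc : adjForm G c = 2 * ∑ i, c i ^ 2 := by
    rw [adjForm_eq_sum_mul_neighborSum, Finset.mul_sum]
    exact Finset.sum_congr rfl fun i _ => by rw [h]; ring
  rcases hle.eq_or_lt with heq | hlt
  · by_cases hs : Function.Surjective f
    · left
      refine ⟨SimpleGraph.Iso.symm ⟨Equiv.ofBijective f ⟨hf, hs⟩, fun {a b} => ?_⟩⟩
      have hab : G.Adj a b ↔ (Γ.comap f).Adj a b := iff_of_eq (congrArg (fun K => K.Adj a b) heq)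
      exact hab.symm
    · right
      obtain ⟨v, hv⟩ : ∃ v, v ∉ Set.range f := by
        simpa [Function.Surjective, Set.mem_range] using hs
      obtain ⟨w₀⟩ := ‹Nonempty W›
      obtain ⟨p⟩ := hΓ.preconnected (f w₀) v
      -- Connectedness supplies an edge leaving the image of f.
      obtain ⟨d, -, ⟨a, ha⟩, hd2⟩ := p.exists_boundary_dart (Set.range f) ⟨w₀, rfl⟩ hv
      let F : Option W → V := fun o => o.elim d.snd f
      have hF : Function.Injective F := by
        rintro (_ | i) (_ | j) hij
        · rfl
        · exact absurd ⟨j, hij.symm⟩ hd2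
        · exact absurd ⟨i, hij⟩ hd2
        · exact congrArg some (hf hij)
      let y : Option W → ℝ := fun o => o.elim (1 / 2) c
      have hadj : (Γ.comap F).Adj none (some a) := by
        change Γ.Adj d.snd (f a)
        rw [ha]
        exact d.adj.symm
      have hy : ∀ i, 0 ≤ y i := by
        rintro (_ | i)
        · change (0 : ℝ) ≤ 1 / 2
          norm_num
        · exact (hpos i).le
      have h1 := adjForm_option hadj hy
      have h2 : adjForm G c ≤ adjForm ((Γ.comap F).comap some) (y ∘ some) :=
        adjForm_mono hle fun i => (hpos i).le
      refine ⟨Function.extend F y 0, ?_⟩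
      rw [sum_sq_extend hF, adjForm_extend hF, Fintype.sum_option]
      have h3 : y none = 1 / 2 := rfl
      have h4 : ∀ i, y (some i) = c i := fun _ => rfl
      simp only [h3, h4] at h1 ⊢
      have := hc a
      linarith
  · right
    refine ⟨Function.extend f c 0, ?_⟩
    rw [sum_sq_extend hf, adjForm_extend hf, ← hGc]
    exact adjForm_strictMono hlt hpos

end Strictness

/-! ### Assembling the trichotomy -/

section Main

variable {V : Type u} [Fintype V] {Γ : SimpleGraph V} {m : ℝ}

theorem one_fourth_lt_of_isDynkin (hΓ : Γ.IsTree) (hm : IsGreatest (sigmaSet.{u, w} Γ) m)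
    (h : IsDynkin Γ) : 1 / 4 < m := by
  have key : ∀ {n : ℕ} {G : SimpleGraph (Fin n)}, (Γ ≃g G) →
      (∃ c : Fin n → ℝ, (∀ i, 0 < c i) ∧ ∀ i, neighborSum G c i < 2 * c i) → 1 / 4 < m := by
    rintro n G e ⟨c, hc, hc2⟩
    exact one_fourth_lt_of_weight hΓ hm (c := c ∘ e) (fun i => hc _) fun i => by
      rw [neighborSum_comp_iso]
      exact hc2 _
  rcases h with ⟨n, -, ⟨e⟩⟩ | ⟨n, hn, ⟨e⟩⟩ | ⟨⟨e⟩⟩ | ⟨⟨e⟩⟩ | ⟨⟨e⟩⟩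
  · exact key e (exists_weight_pathGraph n)
  · exact key e (exists_weight_diagramD hn)
  · exact key e exists_weight_diagramE6
  · exact key e exists_weight_diagramE7
  · exact key e exists_weight_diagramE8

theorem eq_one_fourth_of_isExtendedDynkin (hΓ : Γ.IsTree)
    (hm : IsGreatest (sigmaSet.{u, w} Γ) m) (h : IsExtendedDynkin Γ) : m = 1 / 4 := by
  have key : ∀ {n : ℕ} {G : SimpleGraph (Fin n)}, (Γ ≃g G) →
      (∃ c : Fin n → ℝ, (∀ i, 1 ≤ c i) ∧ ∀ i, neighborSum G c i = 2 * c i) → m = 1 / 4 := by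
    rintro n G e ⟨c, hc, hc2⟩
    exact eq_one_fourth_of_weight hΓ hm (c := c ∘ e) (fun i => one_pos.trans_le (hc _)) fun i => by
      rw [neighborSum_comp_iso]
      exact hc2 _
  rcases h with ⟨n, hn, ⟨e⟩⟩ | ⟨⟨e⟩⟩ | ⟨⟨e⟩⟩ | ⟨⟨e⟩⟩
  · exact key e (exists_weight_diagramExtD hn)
  · exact key e exists_weight_diagramExtE6
  · exact key e exists_weight_diagramExtE7
  · exact key e exists_weight_diagramE9

theorem isExtendedDynkin_or_lt_adjForm (hΓ : Γ.Connected) (h : ContainsExtended Γ) :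
    IsExtendedDynkin Γ ∨ ∃ x : V → ℝ, 2 * ∑ i, x i ^ 2 < adjForm Γ x := by
  rcases h with ⟨n, hn, h⟩ | h | h | h
  · obtain ⟨c, hc, hc2⟩ := exists_weight_diagramExtD hn
    exact (nonempty_iso_or_lt_adjForm hΓ h hc hc2).imp_left fun e => Or.inl ⟨n, hn, e⟩
  · obtain ⟨c, hc, hc2⟩ := exists_weight_diagramExtE6
    exact (nonempty_iso_or_lt_adjForm hΓ h hc hc2).imp_left fun e => Or.inr (Or.inl e)
  · obtain ⟨c, hc, hc2⟩ := exists_weight_diagramExtE7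
    exact (nonempty_iso_or_lt_adjForm hΓ h hc hc2).imp_left fun e => Or.inr (Or.inr (Or.inl e))
  · obtain ⟨c, hc, hc2⟩ := exists_weight_diagramE9
    exact (nonempty_iso_or_lt_adjForm hΓ h hc hc2).imp_left fun e => Or.inr (Or.inr (Or.inr e))

theorem lt_one_fourth_of_not (hΓ : Γ.IsTree) (hm : IsGreatest (sigmaSet.{u, w} Γ) m)
    (h1 : ¬ IsDynkin Γ) (h2 : ¬ IsExtendedDynkin Γ) : m < 1 / 4 := by
  have := hΓ.connected.nonempty
  have hcard : Nat.card V = (Nat.card V - 1) + 1 :=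
    (Nat.sub_add_cancel Nat.card_pos).symm
  have hc := (isDynkin_or_containsExtended _ hΓ hcard).resolve_left h1
  obtain ⟨x, hx⟩ := (isExtendedDynkin_or_lt_adjForm hΓ.connected hc).resolve_left h2
  exact lt_one_fourth_of_lt_adjForm hΓ hm hx

end Main

end SubspaceConfig

theorem mainTheorem2 {V : Type u} [Finite V] (Γ : SimpleGraph V) (hΓ : Γ.IsTree) :
    ∃ m : ℝ, IsGreatest (SubspaceConfig.sigmaSet.{u, w} Γ) m ∧
      (1 / 4 < m ↔ SubspaceConfig.IsDynkin Γ) ∧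
      (m = 1 / 4 ↔ SubspaceConfig.IsExtendedDynkin Γ) ∧
      (¬ SubspaceConfig.IsDynkin Γ → ¬ SubspaceConfig.IsExtendedDynkin Γ → m < 1 / 4) := by
  have := Fintype.ofFinite V
  obtain ⟨m, hm⟩ := SubspaceConfig.exists_isGreatest_sigmaSet.{u, w} hΓ
  have h1 := SubspaceConfig.one_fourth_lt_of_isDynkin hΓ hm
  have h2 := SubspaceConfig.eq_one_fourth_of_isExtendedDynkin hΓ hm
  have h3 := SubspaceConfig.lt_one_fourth_of_not hΓ hm
  -- The three implications cover all cases and their conclusions exclude one another, so the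
  -- converses follow.
  refine ⟨m, hm, ⟨fun h => ?_, h1⟩, ⟨fun h => ?_, h2⟩, h3⟩
  · by_contra hD
    by_cases hE : SubspaceConfig.IsExtendedDynkin Γ
    · exact h.ne' (h2 hE)
    · exact lt_asymm h (h3 hD hE)
  · by_contra hE
    by_cases hD : SubspaceConfig.IsDynkin Γ
    · exact (h1 hD).ne' h
    · exact (h3 hD hE).ne h
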